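/- Crofton's formula in $\mathbb{R}^n$. Let $n\ge 1$ and let $K\subset\mathbb{R}^n$ be a compact set (in particular, a compact $n$-dimensional submanifold with boundary embedded in $\mathbb{R}^n$) whose topological boundary $\Sigma=\partial K$ is $(n-1)$-rectifiable, i.e. covered, up to a set of $(n-1)$-dimensional Hausdorff measure zero, by countably many Lipschitz images of $\mathbb{R}^{n-1}$. Let $\mathcal{L}$ be the space of oriented lines of $\mathbb{R}^n$; each $\ell\in\mathcal{L}$ is determined by its direction $p\in\mathbb{S}^{n-1}$ and its foot $u=\ell\cap p^\perp$, where $p^\perp$ is the linear hyperplane orthogonal to $p$. Equip $\mathcal{L}$ with the invariant measure $d\ell=dS_p\wedge d\ell^\perp_u$, where $dS_p$ is the area element of $\mathbb{S}^{n-1}$ and $d\ell^\perp_u$ the $(n-1)$-dimensional area element of $\ell^\perp=p^\perp$ at $u$. Then $\ell\mapsto\#(\ell\cap\Sigma)\in\{0,1,2,\dots,\infty\}$ is a measurable function on $\mathcal{L}$, and $$\mathcal{V}_{n-1}(\Sigma)=\frac{1}{2\,\omega_{n-1}}\int_{\mathcal{L}}\#(\ell\cap\Sigma)\,d\ell ,$$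 where $\mathcal{V}_{n-1}$ is the $(n-1)$-dimensional surface area (the $(n-1)$-dimensional Hausdorff measure, normalised to agree with Lebesgue measure on $\mathbb{R}^{n-1}$) and $\omega_{n-1}$ is the $(n-1)$-dimensional volume of the unit ball of $\mathbb{R}^{n-1}$ (so $\omega_0=1$). Both sides are elements of $[0,\infty]$ and are infinite simultaneously. -/

import Mathlib

open MeasureTheory Set
open scoped ENNReal RealInnerProductSpace

/-- A set `S` is (countably) `m`-rectifiable if it is covered, up to a set of `m`-dimensional
Hausdorff measure zero, by countably many Lipschitz images of `ℝᵐ`. -/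
def IsRectifiable {n : ℕ} (m : ℕ) (S : Set (EuclideanSpace ℝ (Fin n))) : Prop :=
  ∃ f : ℕ → EuclideanSpace ℝ (Fin m) → EuclideanSpace ℝ (Fin n),
    (∀ i, ∃ C : NNReal, LipschitzWith C (f i)) ∧ μHE[m] (S \ ⋃ i, range (f i)) = 0

/-- The `m`-dimensional volume of a subset of `ℝⁿ`: the `m`-dimensional Hausdorff measure,
normalised so as to agree with Lebesgue measure on `ℝᵐ`. -/
noncomputable def areaOf {n : ℕ} (m : ℕ) (S : Set (EuclideanSpace ℝ (Fin n))) : ℝ≥0∞ :=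
  μHE[m] S

/-- The `m`-dimensional volume of the unit ball of `ℝᵐ`. -/
noncomputable def unitBallVolume (m : ℕ) : ℝ≥0∞ :=
  volume (Metric.ball (0 : EuclideanSpace ℝ (Fin m)) 1)

/-- The unit sphere of directions in `ℝⁿ`. -/
abbrev UnitSphere (n : ℕ) : Type :=
  Metric.sphere (0 : EuclideanSpace ℝ (Fin n)) 1

/-- The subspace of `ℝⁿ` orthogonal to the direction `p`. -/
noncomputable abbrev orthComplement {n : ℕ} (p : UnitSphere n) : Submodule ℝ (EuclideanSpace ℝ (Fin n)) :=
  (Submodule.span ℝ {(p : EuclideanSpace ℝ (Fin n))})ᗮ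

/-- The space of oriented lines of `ℝⁿ`: an oriented line corresponds to exactly one pair
`(p, u)` of its direction `p`, a unit vector, and its foot `u`, the point at which it meets the
subspace orthogonal to `p`. -/
abbrev OrientedLine (n : ℕ) : Type :=
  {l : UnitSphere n × EuclideanSpace ℝ (Fin n) // l.2 ∈ orthComplement l.1}

namespace OrientedLine

/-- The points of an oriented line. -/
def points {n : ℕ} (l : OrientedLine n) : Set (EuclideanSpace ℝ (Fin n)) :=
  {x | ∃ t : ℝ, x = l.1.2 + t • (l.1.1 : EuclideanSpace ℝ (Fin n))}

/-- The oriented line with direction `p` and foot `u`. -/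
def ofFoot {n : ℕ} (p : UnitSphere n) (u : orthComplement p) : OrientedLine n :=
  ⟨(p, u), u.2⟩

/-- The area element of the subspace orthogonal to `p`, as a measure on the space of oriented
lines that is carried by the lines of direction `p`. -/
noncomputable def parallelMeasure {n : ℕ} (p : UnitSphere n) : Measure (OrientedLine n) :=
  (volume : Measure (orthComplement p)).map (ofFoot p)

theorem measurable_ofFoot {n : ℕ} (p : UnitSphere n) : Measurable (ofFoot p) :=
  Measurable.subtype_mk (measurable_const.prodMk measurable_subtype_coe)

/-- The oriented line of direction `q.1` through the point `q.2`. -/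
noncomputable def through {n : ℕ} (q : UnitSphere n × EuclideanSpace ℝ (Fin n)) :
    OrientedLine n :=
  ⟨(q.1, q.2 - ⟪(q.1 : EuclideanSpace ℝ (Fin n)), q.2⟫ • (q.1 : EuclideanSpace ℝ (Fin n))), by
    have h : ‖(q.1 : EuclideanSpace ℝ (Fin n))‖ = 1 := by simp
    rw [orthComplement, Submodule.mem_orthogonal_singleton_iff_inner_right]
    simp [inner_sub_right, inner_smul_right, h]⟩

theorem measurable_through {n : ℕ} : Measurable (through (n := n)) := by
  refine Measurable.subtype_mk (Continuous.measurable ?_)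
  fun_prop

theorem parallelMeasure_apply {n : ℕ} (p : UnitSphere n) {A : Set (OrientedLine n)}
    (hA : MeasurableSet A) :
    parallelMeasure p A = (unitBallVolume 1)⁻¹ *
      volume {x : EuclideanSpace ℝ (Fin n) |
        through (p, x) ∈ A ∧ |⟪(p : EuclideanSpace ℝ (Fin n)), x⟫| < 1} := by
  have hp : ‖(p : EuclideanSpace ℝ (Fin n))‖ = 1 := by simp
  have hp0 : (p : EuclideanSpace ℝ (Fin n)) ≠ 0 := by
    intro h; simp [h] at hp
  set S := Submodule.span ℝ {(p : EuclideanSpace ℝ (Fin n))} with hS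
  have hfr : Module.finrank ℝ S = 1 := finrank_span_singleton hp0
  have : Nontrivial S := Module.nontrivial_of_finrank_pos (R := ℝ) (by omega)
  have hproj (x : EuclideanSpace ℝ (Fin n)) :
      (S.orthogonalProjectionOnto x : EuclideanSpace ℝ (Fin n)) =
        ⟪(p : EuclideanSpace ℝ (Fin n)), x⟫ • (p : EuclideanSpace ℝ (Fin n)) := by
    rw [← Submodule.starProjection_apply]
    exact Submodule.starProjection_unit_singleton ℝ hp x
  have hvol : volume (Metric.ball (0 : S) 1) = unitBallVolume 1 := by
    rw [unitBallVolume, InnerProductSpace.volume_ball, EuclideanSpace.volume_ball, hfr]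
    simp
  have hpos : unitBallVolume 1 ≠ 0 := (Metric.measure_ball_pos _ _ one_pos).ne'
  have hfin : unitBallVolume 1 ≠ ⊤ := measure_ball_lt_top.ne
  have hB : MeasurableSet (ofFoot p ⁻¹' A) := measurable_ofFoot p hA
  have hdec : MeasurePreserving (fun x : EuclideanSpace ℝ (Fin n) =>
      (S.orthogonalProjectionOnto x, Sᗮ.orthogonalProjectionOnto x)) := by
    have h := (WithLp.volume_preserving_ofLp S Sᗮ).comp S.orthogonalDecomposition.measurePreserving
    convert h using 1
    ext x : 1
    simp
  have hset : {x : EuclideanSpace ℝ (Fin n) |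
        through (p, x) ∈ A ∧ |⟪(p : EuclideanSpace ℝ (Fin n)), x⟫| < 1} =
      (fun x : EuclideanSpace ℝ (Fin n) =>
        (S.orthogonalProjectionOnto x, Sᗮ.orthogonalProjectionOnto x)) ⁻¹'
          (Metric.ball (0 : S) 1 ×ˢ (ofFoot p ⁻¹' A)) := by
    ext x
    have h1 : ofFoot p (Sᗮ.orthogonalProjectionOnto x) = through (p, x) := by
      refine Subtype.ext (Prod.ext rfl ?_)
      change (Sᗮ.orthogonalProjectionOnto x : EuclideanSpace ℝ (Fin n)) = x - _
      rw [Submodule.orthogonalProjectionOnto_orthogonal]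
      change x - (S.orthogonalProjectionOnto x : EuclideanSpace ℝ (Fin n)) = _
      rw [hproj]
    have h2 : ‖S.orthogonalProjectionOnto x‖ = |⟪(p : EuclideanSpace ℝ (Fin n)), x⟫| := by
      rw [← Submodule.norm_coe, hproj, norm_smul, hp, mul_one, Real.norm_eq_abs]
    simp only [mem_ofPred_eq, mem_preimage, mem_prod, mem_ball_zero_iff, h1, h2]
    exact and_comm
  rw [parallelMeasure, Measure.map_apply (measurable_ofFoot p) hA, hset,
    hdec.measure_preimage (measurableSet_ball.prod hB).nullMeasurableSet,
    Measure.volume_eq_prod, Measure.prod_prod, hvol, ← mul_assoc, ENNReal.inv_mul_cancel hpos hfin,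
    one_mul]

/-- The parallel measures depend measurably on the direction, so that they can be integrated. -/
theorem measurable_parallelMeasure {n : ℕ} : Measurable (parallelMeasure (n := n)) := by
  refine Measure.measurable_of_measurable_coe _ fun A hA => ?_
  simp_rw [parallelMeasure_apply _ hA]
  refine Measurable.const_mul ?_ _
  refine measurable_measure_prodMk_left (s := {q : UnitSphere n × EuclideanSpace ℝ (Fin n) |
        through q ∈ A ∧ |⟪(q.1 : EuclideanSpace ℝ (Fin n)), q.2⟫| < 1}) ?_
  have hc : Continuous fun q : UnitSphere n × EuclideanSpace ℝ (Fin n) =>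
      |⟪(q.1 : EuclideanSpace ℝ (Fin n)), q.2⟫| := by fun_prop
  exact (measurable_through hA).inter (measurableSet_lt hc.measurable measurable_const)

/-- The number of intersections of an oriented line with a set `S`. -/
noncomputable def intersections {n : ℕ} (S : Set (EuclideanSpace ℝ (Fin n)))
    (l : OrientedLine n) : ℝ≥0∞ :=
  ((l.points ∩ S).encard : ℝ≥0∞)

/-- The invariant measure on the space of oriented lines: the area element of the unit sphere
(for the direction `p`) times the area element of the subspace orthogonal to `p` (for the foot). -/
noncomputable def invariantMeasure (n : ℕ) : Measure (OrientedLine n) :=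
  (volume : Measure (EuclideanSpace ℝ (Fin n))).toSphere.bind parallelMeasure

end OrientedLine

/-! Write `m = n - 1` and `ω` for the volume of the unit ball of `ℝᵐ`. A piece of hyperplane with
unit normal `ν`, projected along `p`, has its area multiplied by `|⟪p, ν⟫|`, and for `⟪p, ν⟫ ≠ 0` a
line of direction `p` meets it at most once. The lines of direction `p` that meet it thus have
measure `|⟪p, ν⟫|` times its area. The integral of `|⟪p, ν⟫|` over the sphere is `2ω` whatever `ν`
is, which is Crofton's formula for this piece.

The general case is reached by approximation. By Rademacher's theorem and linear approximation, a
rectifiable set is, up to a null set, a countable disjoint union of σ-compact pieces whose chords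
are almost orthogonal to a fixed normal (`IsRectifiable.exists_isFlat_cover`). On such a piece,
projection along any `p` outside a thin band around `ν`'s orthogonal hyperplane is injective and
scales area almost by `|⟪p, ν⟫|` (`exists_pos_forall_isFlat_perpProj`). Inside the band the
integrated count is still at most the area (`lintegral_parallelMeasure_intersections_le`), and the
band has small measure. So the formula holds on each piece with `2ω` replaced by any prescribed
bounds `a < 2ω < b`. Null sets are missed by almost every line since projections are 1-Lipschitz, so
the pieces can be summed, and `a` and `b` then tend to `2ω`.

Measurability comes from writing the count as a limit of sums of indicators of sets of lines that
meet small σ-compact cells. -/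

theorem euclideanHausdorffMeasure_image_le_of_dist_le {α X Y : Type*} [MetricSpace X]
    [MeasurableSpace X] [BorelSpace X] [MetricSpace Y] [MeasurableSpace Y] [BorelSpace Y]
    (m : ℕ) {φ : α → X} {ψ : α → Y} {A : Set α} {C : NNReal}
    (h : ∀ x ∈ A, ∀ y ∈ A, dist (φ x) (φ y) ≤ C * dist (ψ x) (ψ y)) :
    μHE[m] (φ '' A) ≤ (C : ℝ≥0∞) ^ m * μHE[m] (ψ '' A) := by
  rcases A.eq_empty_or_nonempty with rfl | ⟨a, -⟩
  · simp
  have : Nonempty α := ⟨a⟩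
  have hinv : ∀ x ∈ A, Function.invFunOn ψ A (ψ x) ∈ A ∧ ψ (Function.invFunOn ψ A (ψ x)) = ψ x :=
    fun x hx => Function.invFunOn_pos ⟨x, hx, rfl⟩
  -- On `A`, equal values of `ψ` force equal values of `φ`, so `φ` factors through `ψ` by a
  -- `C`-Lipschitz map, whichever preimages are chosen.
  have hLip : LipschitzOnWith C (φ ∘ Function.invFunOn ψ A) (ψ '' A) := by
    refine LipschitzOnWith.of_dist_le_mul ?_
    rintro _ ⟨x, hx, rfl⟩ _ ⟨y, hy, rfl⟩
    refine (h _ (hinv x hx).1 _ (hinv y hy).1).trans_eq ?_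
    rw [(hinv x hx).2, (hinv y hy).2]
  have himage : (φ ∘ Function.invFunOn ψ A) '' (ψ '' A) = φ '' A := by
    rw [image_image]
    refine image_congr fun x hx => ?_
    have := h _ (hinv x hx).1 x hx
    rw [(hinv x hx).2, dist_self, mul_zero] at this
    exact dist_le_zero.1 this
  have := hLip.hausdorffMeasure_image_le (d := m) (Nat.cast_nonneg m)
  rw [himage, ENNReal.rpow_natCast] at this
  simp only [Measure.euclideanHausdorffMeasure_def, Measure.smul_apply, ENNReal.smul_def,
    smul_eq_mul]
  rw [mul_left_comm]
  gcongr

/-! ### Projection along a direction, and nearly flat sets -/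

section Perp

variable {V : Type*} [NormedAddCommGroup V] [InnerProductSpace ℝ V]

/-- The orthogonal projection onto the hyperplane orthogonal to the unit vector `p`. -/
noncomputable def perpProj (p : V) : V →L[ℝ] V :=
  ContinuousLinearMap.id ℝ V - (innerSL ℝ p).smulRight p

theorem perpProj_apply (p x : V) : perpProj p x = x - ⟪p, x⟫ • p := by
  simp [perpProj]

theorem inner_perpProj {p : V} (hp : ‖p‖ = 1) (x : V) : ⟪p, perpProj p x⟫ = 0 := by
  simp [perpProj_apply, inner_sub_right, inner_smul_right, hp]

theorem norm_perpProj_sq {p : V} (hp : ‖p‖ = 1) (x : V) :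
    ‖perpProj p x‖ ^ 2 = ‖x‖ ^ 2 - ⟪p, x⟫ ^ 2 := by
  rw [perpProj_apply, norm_sub_sq_real, inner_smul_right, norm_smul, hp, real_inner_comm,
    Real.norm_eq_abs, mul_one, sq_abs]
  ring

theorem norm_perpProj_le {p : V} (hp : ‖p‖ = 1) (x : V) : ‖perpProj p x‖ ≤ ‖x‖ := by
  refine (sq_le_sq₀ (by positivity) (norm_nonneg _)).1 ?_
  rw [norm_perpProj_sq hp]
  nlinarith [sq_nonneg ⟪p, x⟫]

/-- Only the component of `p` orthogonal to `ν`, of squared length `1 - ⟪p, ν⟫ ^ 2`, pairs with `v`;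
Cauchy–Schwarz bounds what the projection removes. -/
theorem abs_inner_mul_norm_le_norm_perpProj {p ν v : V} (hp : ‖p‖ = 1) (hν : ‖ν‖ = 1)
    (hv : ⟪ν, v⟫ = 0) : |⟪p, ν⟫| * ‖v‖ ≤ ‖perpProj p v‖ := by
  refine (sq_le_sq₀ (by positivity) (norm_nonneg _)).1 ?_
  have h1 : ⟪p, v⟫ = ⟪perpProj ν p, v⟫ := by
    rw [perpProj_apply, inner_sub_left, inner_smul_left, hv, mul_zero, sub_zero]
  have h2 : ⟪p, v⟫ ^ 2 ≤ (1 - ⟪p, ν⟫ ^ 2) * ‖v‖ ^ 2 := by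
    have h3 := norm_perpProj_sq hν p
    rw [hp, real_inner_comm, one_pow] at h3
    rw [← h3, ← mul_pow, h1]
    exact sq_le_sq' (neg_le_of_abs_le (abs_real_inner_le_norm _ _)) (real_inner_le_norm _ _)
  rw [norm_perpProj_sq hp, mul_pow, sq_abs]
  linarith

/-- A set is `ε`-flat with normal `ν` if its chords make an angle of sine at most `ε` with the
hyperplane orthogonal to `ν`. -/
def IsFlat (ν : V) (ε : ℝ) (A : Set V) : Prop :=
  ∀ x ∈ A, ∀ y ∈ A, |⟪ν, x - y⟫| ≤ ε * ‖x - y‖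

theorem IsFlat.mono {ν : V} {ε : ℝ} {A B : Set V} (hA : IsFlat ν ε A) (h : B ⊆ A) :
    IsFlat ν ε B :=
  fun x hx y hy => hA x (h hx) y (h hy)

theorem IsFlat.closure {ν : V} {ε : ℝ} {A : Set V} (hA : IsFlat ν ε A) :
    IsFlat ν ε (closure A) := by
  intro x hx y hy
  have hcl : IsClosed {q : V × V | |⟪ν, q.1 - q.2⟫| ≤ ε * ‖q.1 - q.2‖} :=
    isClosed_le (by fun_prop) (by fun_prop)
  have hsub : A ×ˢ A ⊆ {q : V × V | |⟪ν, q.1 - q.2⟫| ≤ ε * ‖q.1 - q.2‖} :=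
    fun q hq => hA _ hq.1 _ hq.2
  have := hcl.closure_subset_iff.2 hsub
  rw [closure_prod_eq] at this
  exact this (mk_mem_prod hx hy)

/-- Flattening a chord `z` onto the hyperplane of `ν` moves it by at most `ε * ‖z‖`, while the
flattened chord has length at least `(1 - ε) * ‖z‖` and keeps at least the fraction `η` of it when
projected along `p`. The condition on `ε` makes the first quantity a fraction `θ` of the last. -/
theorem norm_perpProj_sub_norm_perpProj_le {p ν z : V} {ε θ η : ℝ} (hp : ‖p‖ = 1) (hν : ‖ν‖ = 1)
    (hθ : 0 ≤ θ) (hη : 0 < η) (hε : ε ≤ θ * η * (1 - ε)) (hpν : η ≤ |⟪p, ν⟫|)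
    (hz : |⟪ν, z⟫| ≤ ε * ‖z‖) :
    |‖perpProj p z‖ - ‖perpProj p (perpProj ν z)‖| ≤ θ * ‖perpProj p (perpProj ν z)‖ := by
  have h1 : perpProj p z - perpProj p (perpProj ν z) = ⟪ν, z⟫ • perpProj p ν := by
    rw [← map_sub, ← map_smul, perpProj_apply ν z, sub_sub_cancel]
  have h2 : ‖⟪ν, z⟫ • perpProj p ν‖ ≤ ε * ‖z‖ := by
    rw [norm_smul, Real.norm_eq_abs]
    have := norm_perpProj_le hp ν
    rw [hν] at this
    nlinarith [abs_nonneg ⟪ν, z⟫]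
  have h3 : (1 - ε) * ‖z‖ ≤ ‖perpProj ν z‖ := by
    have h4 : ‖⟪ν, z⟫ • ν‖ ≤ ε * ‖z‖ := by rwa [norm_smul, hν, mul_one]
    have h5 := norm_sub_norm_le z (⟪ν, z⟫ • ν)
    rw [← perpProj_apply] at h5
    linarith
  have h6 := abs_inner_mul_norm_le_norm_perpProj hp hν (inner_perpProj hν z)
  have h7 : η * ‖perpProj ν z‖ ≤ ‖perpProj p (perpProj ν z)‖ :=
    (mul_le_mul_of_nonneg_right hpν (norm_nonneg _)).trans h6
  refine (abs_norm_sub_norm_le _ _).trans ?_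
  rw [h1]
  calc ‖⟪ν, z⟫ • perpProj p ν‖ ≤ ε * ‖z‖ := h2
    _ ≤ θ * η * (1 - ε) * ‖z‖ := by gcongr
    _ = θ * (η * ((1 - ε) * ‖z‖)) := by ring
    _ ≤ θ * (η * ‖perpProj ν z‖) := by gcongr
    _ ≤ _ := by gcongr

theorem euclideanHausdorffMeasure_image_perpProj_le [MeasurableSpace V] [BorelSpace V] {m : ℕ}
    {p : V} (hp : ‖p‖ = 1) (A : Set V) :
    μHE[m] (perpProj p '' A) ≤ μHE[m] A := by
  have := euclideanHausdorffMeasure_image_le_of_dist_le m (φ := perpProj p) (ψ := id) (A := A)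
    (C := 1) fun x _ y _ => by
      rw [dist_eq_norm, ← map_sub, id, id, dist_eq_norm, NNReal.coe_one, one_mul]
      exact norm_perpProj_le hp _
  simpa using this

variable [FiniteDimensional ℝ V]

/-- For an orthonormal basis `b` of the hyperplane, the Gram matrix of the projected basis is the
rank-one perturbation `1 - w wᵀ` with `w i = ⟪p, b i⟫`. Its determinant is `1 - ‖w‖ ^ 2 = ⟪p, ν⟫ ^
2`. -/
theorem normDet_perpProj_comp_subtype {p ν : V} (hp : ‖p‖ = 1) (hν : ‖ν‖ = 1) :
    ((perpProj p).toLinearMap ∘ₗ (Submodule.span ℝ {ν})ᗮ.subtype).normDet = |⟪p, ν⟫| := by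
  set W := (Submodule.span ℝ {ν})ᗮ
  let b := stdOrthonormalBasis ℝ W
  have hq : W.orthogonalProjectionOnto p = perpProj ν p := by
    rw [Submodule.orthogonalProjectionOnto_orthogonal, perpProj_apply]
    exact congrArg (p - ·) (Submodule.starProjection_unit_singleton ℝ hν p)
  have hsum : ∑ i, ⟪p, (b i : V)⟫ ^ 2 = 1 - ⟪p, ν⟫ ^ 2 := by
    have h1 := norm_perpProj_sq hν p
    rw [hp, real_inner_comm, one_pow] at h1
    rw [← h1, ← hq, Submodule.norm_coe, ← b.sum_sq_inner_right]
    refine Finset.sum_congr rfl fun i _ => ?_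
    congr 1
    rw [Submodule.inner_orthogonalProjectionOnto_eq_of_mem_left, real_inner_comm]
  have hgram := LinearMap.normDet_sq_eq_det_gram
    ((perpProj p).toLinearMap ∘ₗ (Submodule.span ℝ {ν})ᗮ.subtype) b
  have hdet : (Matrix.gram ℝ fun i =>
      ((perpProj p).toLinearMap ∘ₗ (Submodule.span ℝ {ν})ᗮ.subtype) (b i)).det = ⟪p, ν⟫ ^ 2 := by
    have : (Matrix.gram ℝ fun i =>
        ((perpProj p).toLinearMap ∘ₗ (Submodule.span ℝ {ν})ᗮ.subtype) (b i)) =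
        1 + Matrix.vecMulVec (fun i => -⟪p, (b i : V)⟫) fun i => ⟪p, (b i : V)⟫ := by
      ext i j
      have hb : ⟪(b i : V), (b j : V)⟫ = (1 : Matrix _ _ ℝ) i j := by
        rw [← Submodule.coe_inner, orthonormal_iff_ite.1 b.orthonormal, Matrix.one_apply]
      have hi : ⟪(b i : V), p⟫ = ⟪p, (b i : V)⟫ := real_inner_comm _ _
      simp only [Matrix.gram_apply, LinearMap.coe_comp, Function.comp_apply,
        ContinuousLinearMap.coe_coe, Submodule.subtype_apply, Matrix.add_apply,
        Matrix.vecMulVec_apply, perpProj_apply, inner_sub_left, inner_sub_right, inner_smul_left,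
        inner_smul_right, hb, hi, real_inner_self_eq_norm_sq, hp, RCLike.conj_to_real]
      ring
    rw [this, Matrix.vecMulVec_eq Unit, Matrix.det_one_add_replicateCol_mul_replicateRow]
    simp only [dotProduct, mul_neg, Finset.sum_neg_distrib, ← sq, hsum]
    ring
  rw [hdet] at hgram
  rw [← Real.sqrt_sq_eq_abs, ← Real.sqrt_sq (LinearMap.normDet_nonneg _)]
  congr 1

variable [MeasurableSpace V] [BorelSpace V] {m : ℕ}

theorem euclideanHausdorffMeasure_image_perpProj (hV : Module.finrank ℝ V = m + 1) {p ν : V}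
    (hp : ‖p‖ = 1) (hν : ‖ν‖ = 1) {B : Set V} (hB : ∀ x ∈ B, ⟪ν, x⟫ = 0) :
    μHE[m] (perpProj p '' B) = ENNReal.ofReal |⟪p, ν⟫| * μHE[m] B := by
  set W := (Submodule.span ℝ {ν})ᗮ with hW
  have hfr : Module.finrank ℝ W = m := by
    have : Fact (Module.finrank ℝ V = m + 1) := ⟨hV⟩
    exact Submodule.finrank_orthogonal_span_singleton (by rintro rfl; simp at hν)
  have hBW : B = W.subtype '' (W.subtype ⁻¹' B) := by
    rw [image_preimage_eq_of_subset]
    intro x hx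
    simpa [hW, Submodule.mem_orthogonal_singleton_iff_inner_right] using hB x hx
  have h := LinearMap.euclideanHausdorffMeasure_image
    ((perpProj p).toLinearMap ∘ₗ (Submodule.span ℝ {ν})ᗮ.subtype) (W.subtype ⁻¹' B)
  rw [hfr, normDet_perpProj_comp_subtype hp hν, LinearMap.coe_comp, image_comp,
    ContinuousLinearMap.coe_coe] at h
  change μHE[m] (perpProj p '' (W.subtype '' (W.subtype ⁻¹' B))) = _ at h
  rw [← hBW] at h
  rw [h]
  congr 1
  conv_rhs => rw [hBW]
  exact (W.subtypeₗᵢ.isometry.euclideanHausdorffMeasure_image _).symm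

/-- A flat enough set is projected injectively in every direction that is not close to the
hyperplane orthogonal to its normal, and its measure is scaled almost as that of a subset of this
hyperplane. -/
theorem exists_pos_forall_isFlat_perpProj (hV : Module.finrank ℝ V = m + 1) {ν : V}
    (hν : ‖ν‖ = 1) {η : ℝ} (hη : 0 < η) (hη1 : η ≤ 1) {C : NNReal} (hC : 1 < C) :
    ∃ ε > 0, ∀ A : Set V, IsFlat ν ε A → ∀ p : V, ‖p‖ = 1 → η ≤ |⟪p, ν⟫| →
      InjOn (perpProj p) A ∧
      μHE[m] (perpProj p '' A) ≤ (C : ℝ≥0∞) ^ m * (ENNReal.ofReal |⟪p, ν⟫| * μHE[m] A) ∧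
      ENNReal.ofReal |⟪p, ν⟫| * μHE[m] A ≤
        (C : ℝ≥0∞) ^ m * ((C : ℝ≥0∞) ^ m * μHE[m] (perpProj p '' A)) := by
  have hC' : (1 : ℝ) < C := by exact_mod_cast hC
  -- This `θ` gives both `C * (1 - θ) = 1` and `1 + θ ≤ C`, so a relative error `θ` costs a factor
  -- `C` in either direction. Then `ε` solves `ε = θ * η * (1 - ε)`, the extreme case of the chord
  -- estimate.
  obtain ⟨θ, hθ⟩ : ∃ θ : ℝ, θ = 1 - 1 / C := ⟨_, rfl⟩
  have hCθ : C * (1 - θ) = (1 : ℝ) := by rw [hθ]; field_simp; ring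
  have hθ0 : 0 < θ := by rw [hθ, sub_pos, div_lt_one (by linarith)]; exact hC'
  have hθ1 : 1 + θ ≤ C := by nlinarith
  obtain ⟨ε, hε⟩ : ∃ ε : ℝ, ε = θ * η / (1 + θ * η) := ⟨_, rfl⟩
  have hθη : 0 < θ * η := by positivity
  have hε0 : 0 < ε := by rw [hε]; positivity
  have hεeq : ε = θ * η * (1 - ε) := by rw [hε]; field_simp; ring
  have hε1 : 1 ≤ C * (1 - ε) := by
    have h1 : (1 + θ * η) * (1 - ε) = 1 := by linear_combination -hεeq
    have h2 : 0 ≤ 1 - ε := by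
      by_contra h
      nlinarith
    have h3 : 1 + θ * η ≤ C := by nlinarith
    nlinarith
  refine ⟨ε, hε0, fun A hA p hp hpν => ?_⟩
  have hkey : ∀ x ∈ A, ∀ y ∈ A, |‖perpProj p (x - y)‖ - ‖perpProj p (perpProj ν (x - y))‖| ≤
      θ * ‖perpProj p (perpProj ν (x - y))‖ := fun x hx y hy =>
    norm_perpProj_sub_norm_perpProj_le hp hν hθ0.le hη hεeq.le hpν (hA x hx y hy)
  have hνlow : ∀ x ∈ A, ∀ y ∈ A, ‖x - y‖ ≤ C * ‖perpProj ν (x - y)‖ := by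
    intro x hx y hy
    have h4 : ‖⟪ν, x - y⟫ • ν‖ ≤ ε * ‖x - y‖ := by
      rw [norm_smul, hν, mul_one]
      exact hA x hx y hy
    have h5 := norm_sub_norm_le (x - y) (⟪ν, x - y⟫ • ν)
    rw [← perpProj_apply] at h5
    nlinarith [norm_nonneg (x - y)]
  have hup : ∀ x ∈ A, ∀ y ∈ A,
      ‖perpProj p (x - y)‖ ≤ C * ‖perpProj p (perpProj ν (x - y))‖ := by
    intro x hx y hy
    have := (abs_le.1 (hkey x hx y hy)).2
    nlinarith [norm_nonneg (perpProj p (perpProj ν (x - y)))]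
  have hlow : ∀ x ∈ A, ∀ y ∈ A,
      ‖perpProj p (perpProj ν (x - y))‖ ≤ C * ‖perpProj p (x - y)‖ := by
    intro x hx y hy
    have := (abs_le.1 (hkey x hx y hy)).1
    nlinarith [norm_nonneg (perpProj p (perpProj ν (x - y)))]
  have hlin : μHE[m] (perpProj p '' (perpProj ν '' A)) =
      ENNReal.ofReal |⟪p, ν⟫| * μHE[m] (perpProj ν '' A) := by
    refine euclideanHausdorffMeasure_image_perpProj hV hp hν ?_
    rintro _ ⟨x, -, rfl⟩
    exact inner_perpProj hν x
  refine ⟨fun x hx y hy hxy => ?_, ?_, ?_⟩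
  · have h1 := hlow x hx y hy
    rw [map_sub (perpProj p) x y, sub_eq_zero.2 hxy, norm_zero, mul_zero] at h1
    have h2 := abs_inner_mul_norm_le_norm_perpProj hp hν (inner_perpProj hν (x - y))
    have h3 : ‖perpProj ν (x - y)‖ ≤ 0 := by
      by_contra! h
      nlinarith
    have h4 := hνlow x hx y hy
    have h5 : ‖x - y‖ ≤ 0 := by nlinarith
    exact sub_eq_zero.1 (norm_le_zero_iff.1 h5)
  · calc μHE[m] (perpProj p '' A)
        ≤ (C : ℝ≥0∞) ^ m * μHE[m] ((fun x => perpProj p (perpProj ν x)) '' A) :=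
          euclideanHausdorffMeasure_image_le_of_dist_le m fun x hx y hy => by
            simpa only [dist_eq_norm, map_sub] using hup x hx y hy
      _ = (C : ℝ≥0∞) ^ m * (ENNReal.ofReal |⟪p, ν⟫| * μHE[m] (perpProj ν '' A)) := by
          rw [← hlin, image_image]
      _ ≤ _ := by
          gcongr _ * (_ * ?_)
          exact euclideanHausdorffMeasure_image_perpProj_le hν A
  -- The factor `C ^ m` is lost twice: in flattening `A` onto the hyperplane of `ν`, and in
  -- comparing the two projections along `p`.
  · calc ENNReal.ofReal |⟪p, ν⟫| * μHE[m] A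
        ≤ ENNReal.ofReal |⟪p, ν⟫| * ((C : ℝ≥0∞) ^ m * μHE[m] (perpProj ν '' A)) := by
          gcongr
          have := euclideanHausdorffMeasure_image_le_of_dist_le m (φ := id) (ψ := perpProj ν)
            (A := A) (C := C) fun x hx y hy => by
              simpa only [dist_eq_norm, map_sub, id] using hνlow x hx y hy
          rwa [image_id] at this
      _ = (C : ℝ≥0∞) ^ m * μHE[m] ((fun x => perpProj p (perpProj ν x)) '' A) := by
          rw [mul_left_comm, ← hlin, image_image]
      _ ≤ _ := by
          gcongr
          exact euclideanHausdorffMeasure_image_le_of_dist_le m fun x hx y hy => by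
            simpa only [dist_eq_norm, map_sub] using hlow x hx y hy

end Perp

/-! ### Counting points with fine partitions -/

open Filter Topology in
-- Occupied cells never outnumber the points, since each holds a point of its own. Conversely, any
-- finite set of points of `s` is eventually separated by the cells. Testing against finite subsets
-- also covers infinite `s`.
theorem tendsto_encard_nonempty_inter {X : Type*} [MetricSpace X] (s : Set X) (Q : ℕ → ℕ → Set X)
    (hdisj : ∀ k, Pairwise (Function.onFun Disjoint (Q k))) (hcover : ∀ k, ⋃ i, Q k i = univ)
    (hdist : ∀ k i, ∀ x ∈ Q k i, ∀ y ∈ Q k i, dist x y ≤ 1 / ((k : ℝ) + 1)) :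
    Tendsto (fun k => (({i | (s ∩ Q k i).Nonempty}.encard : ℕ∞) : ℝ≥0∞)) atTop
      (𝓝 (s.encard : ℝ≥0∞)) := by
  have hle : ∀ k, {i | (s ∩ Q k i).Nonempty}.encard ≤ s.encard := by
    intro k
    rcases s.eq_empty_or_nonempty with rfl | ⟨a, -⟩
    · simp
    have : Nonempty X := ⟨a⟩
    choose! g hg using fun i (hi : i ∈ {i | (s ∩ Q k i).Nonempty}) => hi
    refine encard_le_encard_of_injOn (fun i hi => (hg i hi).1) fun i hi j hj hij => ?_
    by_contra hne
    exact (hdisj k hne).le_bot ⟨(hg i hi).2, hij ▸ (hg j hj).2⟩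
  have hev : ∀ j : ℕ, (j : ℕ∞) ≤ s.encard →
      ∀ᶠ k in atTop, (j : ℕ∞) ≤ {i | (s ∩ Q k i).Nonempty}.encard := by
    intro j hj
    obtain ⟨t, hts, htj⟩ := exists_subset_encard_eq hj
    have htfin : t.Finite := finite_of_encard_eq_coe htj
    have hsep : ∀ᶠ k : ℕ in atTop, ∀ x ∈ t, ∀ y ∈ t, dist x y ≤ 1 / ((k : ℝ) + 1) → x = y := by
      rw [htfin.eventually_all]
      intro x _
      rw [htfin.eventually_all]
      intro y _
      by_cases hxy : x = y
      · exact Eventually.of_forall fun _ _ => hxy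
      · filter_upwards [(tendsto_order.1 (tendsto_one_div_add_atTop_nhds_zero_nat (𝕜 := ℝ))).2 _
          (dist_pos.2 hxy)] with k hk h
        exact absurd h (not_le.2 hk)
    filter_upwards [hsep] with k hk
    have hmem : ∀ x, ∃ i, x ∈ Q k i := fun x => mem_iUnion.1 (hcover k ▸ mem_univ x)
    choose c hc using hmem
    rw [← htj]
    refine encard_le_encard_of_injOn (f := c) (fun x hx => ⟨x, hts hx, hc x⟩) fun x hx y hy h => ?_
    exact hk x hx y hy (hdist k (c x) x (hc x) y (h ▸ hc y))
  refine tendsto_order.2 ⟨fun a ha => ?_, fun a ha => Eventually.of_forall fun k => ?_⟩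
  · obtain ⟨j, hj, haj⟩ : ∃ j : ℕ, (j : ℕ∞) ≤ s.encard ∧ a < (j : ℝ≥0∞) := by
      by_cases h : s.encard = ⊤
      · obtain ⟨j, hj⟩ := ENNReal.exists_nat_gt (ne_top_of_lt ha)
        exact ⟨j, h ▸ le_top, hj⟩
      · obtain ⟨j, hj⟩ := ENat.ne_top_iff_exists.1 h
        refine ⟨j, hj.le, ?_⟩
        rwa [← hj] at ha
    filter_upwards [hev j hj] with k hk
    refine haj.trans_le ?_
    rw [← ENat.toENNReal_coe]
    exact ENat.toENNReal_le.2 hk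
  · exact (ENat.toENNReal_le.2 (hle k)).trans_lt ha

theorem ENat.toENNReal_encard_eq_tsum {ι : Type*} (s : Set ι) :
    ((s.encard : ℕ∞) : ℝ≥0∞) = ∑' i, s.indicator (fun _ => (1 : ℝ≥0∞)) i := by
  rw [← tsum_subtype, ENNReal.tsum_set_one]

theorem IsSigmaCompact.inter {X : Type*} [TopologicalSpace X] [T2Space X] {A B : Set X}
    (hA : IsSigmaCompact A) (hB : IsSigmaCompact B) : IsSigmaCompact (A ∩ B) := by
  obtain ⟨K, hK, rfl⟩ := hA
  obtain ⟨L, hL, rfl⟩ := hB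
  rw [iUnion_inter]
  refine isSigmaCompact_iUnion _ fun i => ?_
  rw [inter_iUnion]
  exact isSigmaCompact_iUnion _ fun j => ((hK i).inter (hL j)).isSigmaCompact

theorem IsSigmaCompact.measurableSet {X : Type*} [TopologicalSpace X] [T2Space X]
    [MeasurableSpace X] [OpensMeasurableSpace X] {A : Set X} (hA : IsSigmaCompact A) :
    MeasurableSet A := by
  obtain ⟨K, hK, rfl⟩ := hA
  exact MeasurableSet.iUnion fun i => (hK i).measurableSet

theorem IsLocallyClosed.isSigmaCompact {X : Type*} [TopologicalSpace X] [LocallyCompactSpace X]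
    [SecondCountableTopology X] {A : Set X} (hA : IsLocallyClosed A) : IsSigmaCompact A := by
  have := hA.locallyCompactSpace
  exact isSigmaCompact_iff_sigmaCompactSpace.2 inferInstance

theorem isLocallyClosed_disjointed {X : Type*} [TopologicalSpace X] {C : ℕ → Set X}
    (hC : ∀ i, IsClosed (C i)) (i : ℕ) : IsLocallyClosed (disjointed C i) := by
  rw [disjointed_eq_inter_compl]
  refine (hC i).isLocallyClosed.inter (IsOpen.isLocallyClosed ?_)
  exact (finite_Iio i).isOpen_biInter fun j _ => (hC j).isOpen_compl

/-- Countable partitions into locally closed sets of arbitrarily small diameter. -/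
theorem exists_partition_isLocallyClosed (X : Type*) [MetricSpace X] [SecondCountableTopology X]
    [Nonempty X] :
    ∃ Q : ℕ → ℕ → Set X, (∀ k i, IsLocallyClosed (Q k i)) ∧
      (∀ k, Pairwise (Function.onFun Disjoint (Q k))) ∧ (∀ k, ⋃ i, Q k i = univ) ∧
      ∀ k i, ∀ x ∈ Q k i, ∀ y ∈ Q k i, dist x y ≤ 1 / ((k : ℝ) + 1) := by
  let C : ℕ → ℕ → Set X := fun k i =>
    Metric.closedBall (TopologicalSpace.denseSeq X i) (1 / ((k : ℝ) + 1) / 2)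
  refine ⟨fun k => disjointed (C k),
    fun k => isLocallyClosed_disjointed fun i => Metric.isClosed_closedBall,
    fun k => disjoint_disjointed _, fun k => ?_, fun k i x hx y hy => ?_⟩
  · rw [iUnion_disjointed, eq_univ_iff_forall]
    intro x
    obtain ⟨i, hi⟩ := (TopologicalSpace.denseRange_denseSeq X).exists_dist_lt x
      (show (0 : ℝ) < 1 / ((k : ℝ) + 1) / 2 by positivity)
    exact mem_iUnion.2 ⟨i, hi.le⟩
  · have hx' := disjointed_subset (C k) i hx
    have hy' := disjointed_subset (C k) i hy
    have := dist_triangle_right x y (TopologicalSpace.denseSeq X i)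
    rw [Metric.mem_closedBall] at hx' hy'
    linarith

/-! ### Lines that meet a set: measurability and integration over one direction -/

namespace OrientedLine

variable {n : ℕ}

theorem norm_coe_unitSphere (p : UnitSphere n) : ‖(p : EuclideanSpace ℝ (Fin n))‖ = 1 := by
  simp

theorem mem_points_iff {l : OrientedLine n} {x : EuclideanSpace ℝ (Fin n)} :
    x ∈ l.points ↔ through (l.1.1, x) = l := by
  have hu := l.2
  rw [orthComplement, Submodule.mem_orthogonal_singleton_iff_inner_right] at hu
  constructor
  · rintro ⟨t, rfl⟩
    refine Subtype.ext (Prod.ext rfl ?_)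
    simp [through, inner_add_right, hu, inner_smul_right]
  · intro h
    refine ⟨⟪(l.1.1 : EuclideanSpace ℝ (Fin n)), x⟫, ?_⟩
    have h2 : x - ⟪(l.1.1 : EuclideanSpace ℝ (Fin n)), x⟫ • (l.1.1 : EuclideanSpace ℝ (Fin n)) =
      l.1.2 := congrArg (fun l => l.1.2) h
    rw [← h2, sub_add_cancel]

theorem mem_points_ofFoot_iff {p : UnitSphere n} {u : orthComplement p}
    {x : EuclideanSpace ℝ (Fin n)} :
    x ∈ (ofFoot p u).points ↔ perpProj (p : EuclideanSpace ℝ (Fin n)) x = u := by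
  rw [mem_points_iff, perpProj_apply]
  constructor
  · exact fun h => congrArg (fun l => l.1.2) h
  · exact fun h => Subtype.ext (Prod.ext rfl h)

theorem continuous_through : Continuous (through (n := n)) := by
  refine Continuous.subtype_mk ?_ _
  fun_prop

/-- The lines that meet a set. -/
def meeting (A : Set (EuclideanSpace ℝ (Fin n))) : Set (OrientedLine n) :=
  {l | (l.points ∩ A).Nonempty}

/-- These lines form the image of sphere times `A` under `through`. Continuous images preserve
σ-compactness but not Borel measurability, which is why every piece is kept σ-compact. -/
theorem isSigmaCompact_meeting {A : Set (EuclideanSpace ℝ (Fin n))} (hA : IsSigmaCompact A) :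
    IsSigmaCompact (meeting A) := by
  have h : meeting A = through '' (univ ×ˢ A) := by
    ext l
    constructor
    · rintro ⟨x, hx, hxA⟩
      exact ⟨(l.1.1, x), ⟨mem_univ _, hxA⟩, mem_points_iff.1 hx⟩
    · rintro ⟨⟨p, x⟩, ⟨-, hx⟩, rfl⟩
      exact ⟨x, mem_points_iff.2 rfl, hx⟩
  rw [h]
  obtain ⟨K, hK, rfl⟩ := hA
  refine IsSigmaCompact.image continuous_through ?_
  rw [prod_iUnion]
  exact isSigmaCompact_iUnion _ fun i => (isCompact_univ.prod (hK i)).isSigmaCompact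

theorem exists_tendsto_intersections {A : Set (EuclideanSpace ℝ (Fin n))} (hA : IsSigmaCompact A) :
    ∃ Q : ℕ → ℕ → Set (EuclideanSpace ℝ (Fin n)), (∀ k i, IsSigmaCompact (A ∩ Q k i)) ∧
      (∀ k, Pairwise (Function.onFun Disjoint (Q k))) ∧
      ∀ l, Filter.Tendsto
        (fun k => ∑' i, (meeting (A ∩ Q k i)).indicator (fun _ => (1 : ℝ≥0∞)) l)
        Filter.atTop (nhds (intersections A l)) := by
  obtain ⟨Q, hQ, hdisj, hcover, hdist⟩ :=
    exists_partition_isLocallyClosed (EuclideanSpace ℝ (Fin n))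
  refine ⟨Q, fun k i => hA.inter (hQ k i).isSigmaCompact, hdisj, fun l => ?_⟩
  have := tendsto_encard_nonempty_inter (l.points ∩ A) Q hdisj hcover hdist
  refine this.congr fun k => ?_
  rw [ENat.toENNReal_encard_eq_tsum]
  refine tsum_congr fun i => ?_
  simp only [inter_assoc]
  rfl

theorem measurable_intersections {A : Set (EuclideanSpace ℝ (Fin n))} (hA : IsSigmaCompact A) :
    Measurable (intersections A) := by
  obtain ⟨Q, hQ, -, hlim⟩ := exists_tendsto_intersections hA
  refine measurable_of_tendsto_metrizable (f := fun k l =>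
    ∑' i, (meeting (A ∩ Q k i)).indicator (fun _ => (1 : ℝ≥0∞)) l) (fun k => ?_)
    (tendsto_pi_nhds.2 hlim)
  exact Measurable.tsum fun i =>
    measurable_const.indicator (isSigmaCompact_meeting (hQ k i)).measurableSet

theorem lintegral_intersections {A : Set (EuclideanSpace ℝ (Fin n))} (hA : IsSigmaCompact A) :
    ∫⁻ l, intersections A l ∂invariantMeasure n =
      ∫⁻ p, ∫⁻ l, intersections A l ∂parallelMeasure p
        ∂(volume : Measure (EuclideanSpace ℝ (Fin n))).toSphere :=
  Measure.lintegral_bind measurable_parallelMeasure.aemeasurable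
    (measurable_intersections hA).aemeasurable

variable {m : ℕ}

/-- The feet of the lines of direction `p` that meet `A` are exactly the projections of the points
of `A`. With no measurability assumed, this applies to arbitrary null sets. -/
theorem volume_ofFoot_preimage_meeting (p : UnitSphere (m + 1))
    (A : Set (EuclideanSpace ℝ (Fin (m + 1)))) :
    volume (ofFoot p ⁻¹' meeting A) =
      μHE[m] (perpProj (p : EuclideanSpace ℝ (Fin (m + 1))) '' A) := by
  have hfr : Module.finrank ℝ (orthComplement p) = m := by
    have : Fact (Module.finrank ℝ (EuclideanSpace ℝ (Fin (m + 1))) = m + 1) := ⟨by simp⟩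
    refine Submodule.finrank_orthogonal_span_singleton fun h => ?_
    have := norm_coe_unitSphere p
    simp [h] at this
  have himage : Subtype.val '' (ofFoot p ⁻¹' meeting A) =
      perpProj (p : EuclideanSpace ℝ (Fin (m + 1))) '' A := by
    ext y
    constructor
    · rintro ⟨u, ⟨x, hx, hxA⟩, rfl⟩
      exact ⟨x, hxA, mem_points_ofFoot_iff.1 hx⟩
    · rintro ⟨x, hx, rfl⟩
      refine ⟨⟨perpProj (p : EuclideanSpace ℝ (Fin (m + 1))) x, ?_⟩, ⟨x, ?_, hx⟩, rfl⟩
      · rw [orthComplement, Submodule.mem_orthogonal_singleton_iff_inner_right]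
        exact inner_perpProj (norm_coe_unitSphere p) x
      · exact mem_points_ofFoot_iff.2 rfl
  rw [← himage, isometry_subtype_coe.euclideanHausdorffMeasure_image,
    ← InnerProductSpace.euclideanHausdorffMeasure_eq_volume, hfr]

theorem parallelMeasure_meeting (p : UnitSphere (m + 1))
    {A : Set (EuclideanSpace ℝ (Fin (m + 1)))} (hA : IsSigmaCompact A) :
    parallelMeasure p (meeting A) =
      μHE[m] (perpProj (p : EuclideanSpace ℝ (Fin (m + 1))) '' A) := by
  rw [parallelMeasure, Measure.map_apply (measurable_ofFoot p)
    (isSigmaCompact_meeting hA).measurableSet, volume_ofFoot_preimage_meeting]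

/-- A crude bound for nearly tangent directions, where injectivity fails. It holds for each
approximating sum over cells, because projection does not increase area, and passes to the limit by
Fatou's lemma. -/
theorem lintegral_parallelMeasure_intersections_le (p : UnitSphere (m + 1))
    {A : Set (EuclideanSpace ℝ (Fin (m + 1)))} (hA : IsSigmaCompact A) :
    ∫⁻ l, intersections A l ∂parallelMeasure p ≤ μHE[m] A := by
  obtain ⟨Q, hQ, hdisj, hlim⟩ := exists_tendsto_intersections hA
  have hmeas : ∀ k i, Measurable
      ((meeting (A ∩ Q k i)).indicator (fun _ => (1 : ℝ≥0∞))) := fun k i =>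
    measurable_const.indicator (isSigmaCompact_meeting (hQ k i)).measurableSet
  have hle : ∀ k, ∫⁻ l, ∑' i, (meeting (A ∩ Q k i)).indicator (fun _ => (1 : ℝ≥0∞)) l
      ∂parallelMeasure p ≤ μHE[m] A := by
    intro k
    rw [lintegral_tsum fun i => (hmeas k i).aemeasurable]
    calc ∑' i, ∫⁻ l, (meeting (A ∩ Q k i)).indicator (fun _ => (1 : ℝ≥0∞)) l ∂parallelMeasure p
        = ∑' i, μHE[m] (perpProj (p : EuclideanSpace ℝ (Fin (m + 1))) '' (A ∩ Q k i)) := by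
          refine tsum_congr fun i => ?_
          rw [lintegral_indicator (isSigmaCompact_meeting (hQ k i)).measurableSet,
            setLIntegral_one, parallelMeasure_meeting p (hQ k i)]
      _ ≤ ∑' i, μHE[m] (A ∩ Q k i) := ENNReal.tsum_le_tsum fun i =>
          euclideanHausdorffMeasure_image_perpProj_le (norm_coe_unitSphere p) _
      _ = μHE[m] (⋃ i, A ∩ Q k i) := by
          rw [measure_iUnion _ fun i => (hQ k i).measurableSet]
          exact fun i j hij => (hdisj k hij).mono inter_subset_right inter_subset_right
      _ ≤ μHE[m] A := measure_mono (iUnion_subset fun i => inter_subset_left)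
  calc ∫⁻ l, intersections A l ∂parallelMeasure p
      = ∫⁻ l, Filter.liminf (fun k =>
          ∑' i, (meeting (A ∩ Q k i)).indicator (fun _ => (1 : ℝ≥0∞)) l) Filter.atTop
          ∂parallelMeasure p := lintegral_congr fun l => (hlim l).liminf_eq.symm
    _ ≤ Filter.liminf (fun k => ∫⁻ l,
          ∑' i, (meeting (A ∩ Q k i)).indicator (fun _ => (1 : ℝ≥0∞)) l ∂parallelMeasure p)
          Filter.atTop := lintegral_liminf_le fun k => Measurable.tsum (hmeas k)
    _ ≤ μHE[m] A := Filter.liminf_le_of_le (by isBoundedDefault) fun b hb => by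
          obtain ⟨k, hk⟩ := hb.exists
          exact hk.trans (hle k)

theorem lintegral_parallelMeasure_intersections_of_injOn (p : UnitSphere (m + 1))
    {A : Set (EuclideanSpace ℝ (Fin (m + 1)))} (hA : IsSigmaCompact A)
    (hinj : InjOn (perpProj (p : EuclideanSpace ℝ (Fin (m + 1)))) A) :
    ∫⁻ l, intersections A l ∂parallelMeasure p =
      μHE[m] (perpProj (p : EuclideanSpace ℝ (Fin (m + 1))) '' A) := by
  rw [← parallelMeasure_meeting p hA,
    ← lintegral_indicator_one (isSigmaCompact_meeting hA).measurableSet, parallelMeasure,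
    lintegral_map (measurable_intersections hA) (measurable_ofFoot p),
    lintegral_map (measurable_one.indicator (isSigmaCompact_meeting hA).measurableSet)
      (measurable_ofFoot p)]
  refine lintegral_congr fun u => ?_
  by_cases h : ((ofFoot p u).points ∩ A).Nonempty
  · rw [indicator_of_mem (show ofFoot p u ∈ meeting A from h)]
    obtain ⟨x, hx, hxA⟩ := h
    have : (ofFoot p u).points ∩ A = {x} := by
      refine Subset.antisymm (fun y hy => ?_) (singleton_subset_iff.2 ⟨hx, hxA⟩)
      exact hinj hy.2 hxA
        ((mem_points_ofFoot_iff.1 hy.1).trans (mem_points_ofFoot_iff.1 hx).symm)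
    simp [intersections, this]
  · rw [indicator_of_notMem (show ofFoot p u ∉ meeting A from h)]
    rw [not_nonempty_iff_eq_empty] at h
    simp [intersections, h]

theorem intersections_ofFoot_ae_eq_zero (p : UnitSphere (m + 1))
    {A : Set (EuclideanSpace ℝ (Fin (m + 1)))} (hA : μHE[m] A = 0) :
    ∀ᵐ u : orthComplement p, intersections A (ofFoot p u) = 0 := by
  have h0 : volume (ofFoot p ⁻¹' meeting A) = 0 := by
    rw [volume_ofFoot_preimage_meeting]
    exact le_antisymm ((euclideanHausdorffMeasure_image_perpProj_le
      (norm_coe_unitSphere p) A).trans_eq hA) zero_le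
  filter_upwards [measure_eq_zero_iff_ae_notMem.1 h0] with u hu
  have : (ofFoot p u).points ∩ A = ∅ := not_nonempty_iff_eq_empty.1 hu
  simp [intersections, this]

theorem intersections_iUnion {A : ℕ → Set (EuclideanSpace ℝ (Fin n))}
    (hdisj : Pairwise (Function.onFun Disjoint A)) (l : OrientedLine n) :
    intersections (⋃ i, A i) l = ∑' i, intersections (A i) l := by
  -- For the discrete σ-algebra, cardinality is the counting measure, so countable additivity needs
  -- no measurability of the pieces.
  let _ : MeasurableSpace (EuclideanSpace ℝ (Fin n)) := ⊤
  have h : ∀ s : Set (EuclideanSpace ℝ (Fin n)), Measure.count s = (s.encard : ℝ≥0∞) :=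
    fun s => Measure.count_apply trivial
  simp only [intersections, inter_iUnion, ← h]
  exact measure_iUnion (fun i j hij => (hdisj hij).mono inter_subset_right inter_subset_right)
    fun i => trivial

theorem intersections_union {A B : Set (EuclideanSpace ℝ (Fin n))}
    (hdisj : Disjoint A B) (l : OrientedLine n) :
    intersections (A ∪ B) l = intersections A l + intersections B l := by
  rw [intersections, inter_union_distrib_left, encard_union_eq, ENat.toENNReal_add]
  · rfl
  · exact hdisj.mono inter_subset_right inter_subset_right

end OrientedLine

/-! ### Points with noninjective derivative -/

section Singular

variable {U V : Type*} [NormedAddCommGroup U] [InnerProductSpace ℝ U]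
  [NormedAddCommGroup V] [InnerProductSpace ℝ V]

/-- The linear map whose graph is parametrized by `x ↦ (L x, s • x)`. -/
noncomputable def scaledGraph (L : U →L[ℝ] V) (s : ℝ) : U →ₗ[ℝ] WithLp 2 (V × U) :=
  (WithLp.linearEquiv 2 ℝ (V × U)).symm.toLinearMap ∘ₗ L.toLinearMap.prod (s • LinearMap.id)

theorem inner_scaledGraph (L : U →L[ℝ] V) (s : ℝ) (x y : U) :
    ⟪scaledGraph L s x, scaledGraph L s y⟫ = ⟪L x, L y⟫ + s ^ 2 * ⟪x, y⟫ := by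
  simp [scaledGraph, WithLp.prod_inner_apply, inner_smul_left, inner_smul_right]
  ring

theorem norm_scaledGraph_sq (L : U →L[ℝ] V) (s : ℝ) (x : U) :
    ‖scaledGraph L s x‖ ^ 2 = ‖L x‖ ^ 2 + s ^ 2 * ‖x‖ ^ 2 := by
  simp only [← real_inner_self_eq_norm_sq, inner_scaledGraph]

variable [FiniteDimensional ℝ U]

/-- The squared determinant is the Gram determinant of the graph, continuous in `s` and zero at `s =
0`. A strictly positive `s` is required because it becomes an approximation radius. -/
theorem exists_normDet_scaledGraph_lt {L : U →L[ℝ] V} (hL : ¬ Function.Injective L) {τ : ℝ}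
    (hτ : 0 < τ) : ∃ s > 0, (scaledGraph L s).normDet < τ := by
  let b := stdOrthonormalBasis ℝ U
  let F : ℝ → ℝ := fun s =>
    (Matrix.gram ℝ (fun i => L (b i)) + s ^ 2 • (Matrix.gram ℝ fun i => b i)).det
  have hF : ∀ s, (scaledGraph L s).normDet ^ 2 = F s := by
    intro s
    have h := LinearMap.normDet_sq_eq_det_gram (scaledGraph L s) b
    refine h.trans (congrArg Matrix.det ?_)
    ext i j
    exact inner_scaledGraph L s (b i) (b j)
  have hF0 : F 0 = 0 := by
    have h := LinearMap.normDet_sq_eq_det_gram L.toLinearMap b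
    have h0 : L.toLinearMap.normDet = 0 :=
      (L.toLinearMap.normDet_eq_zero_tfae.out 5 0).1 hL
    rw [h0] at h
    simpa [F] using h.symm
  have hcont : Continuous F := by
    refine Continuous.matrix_det ?_
    fun_prop
  have hev : ∀ᶠ s in nhdsWithin 0 (Ioi 0), F s < τ ^ 2 := by
    have := hcont.tendsto 0
    rw [hF0] at this
    exact (this.mono_left nhdsWithin_le_nhds).eventually_lt_const (by positivity)
  obtain ⟨s, hs, hs0⟩ := (hev.and self_mem_nhdsWithin).exists
  exact ⟨s, hs0, lt_of_pow_lt_pow_left₀ 2 hτ.le ((hF s).trans_lt hs)⟩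

variable [MeasurableSpace U] [BorelSpace U] [MeasurableSpace V] [BorelSpace V]

/-- Since `‖f x - f y‖ ≤ ‖L (x - y)‖ + s * ‖x - y‖` and the scaled graph dominates each summand, `f
'' T` is a 2-Lipschitz image of the linear set `scaledGraph L s '' T`, whose measure is explicit. -/
theorem ApproximatesLinearOn.euclideanHausdorffMeasure_image_le [SecondCountableTopology V]
    {f : U → V} {L : U →L[ℝ] V}
    {T : Set U} {s : NNReal} (hf : ApproximatesLinearOn f L T s) :
    μHE[Module.finrank ℝ U] (f '' T) ≤ 2 ^ Module.finrank ℝ U *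
      (ENNReal.ofReal (scaledGraph L s).normDet * volume T) := by
  rw [← LinearMap.euclideanHausdorffMeasure_image_eq_normDet_mul_volume]
  refine euclideanHausdorffMeasure_image_le_of_dist_le _ (C := 2) fun x hx y hy => ?_
  rw [dist_eq_norm, dist_eq_norm, ← map_sub]
  have h1 : ‖L (x - y)‖ ≤ ‖scaledGraph L s (x - y)‖ := by
    refine (sq_le_sq₀ (norm_nonneg _) (norm_nonneg _)).1 ?_
    rw [norm_scaledGraph_sq]
    nlinarith [mul_nonneg (sq_nonneg (s : ℝ)) (sq_nonneg ‖x - y‖)]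
  have h2 : s * ‖x - y‖ ≤ ‖scaledGraph L s (x - y)‖ := by
    refine (sq_le_sq₀ (by positivity) (norm_nonneg _)).1 ?_
    rw [norm_scaledGraph_sq]
    nlinarith [sq_nonneg ‖L (x - y)‖]
  have h3 := hf x hx y hy
  have h4 := norm_sub_norm_le (f x - f y) (L (x - y))
  push_cast
  linarith

/-- The image of the points with noninjective derivative is negligible. -/
theorem euclideanHausdorffMeasure_image_eq_zero_of_not_injective_fderiv
    [SecondCountableTopology V] {f : U → V} {f' : U → U →L[ℝ] V} {D : Set U}
    (hf : ∀ x ∈ D, HasFDerivWithinAt f (f' x) D x) (hf' : ∀ x ∈ D, ¬ Function.Injective (f' x)) :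
    μHE[Module.finrank ℝ U] (f '' D) = 0 := by
  have hbdd : ∀ R : ℕ, μHE[Module.finrank ℝ U] (f '' (D ∩ Metric.ball 0 R)) = 0 := by
    intro R
    set B := Metric.ball (0 : U) R
    have hle : ∀ k : ℕ, μHE[Module.finrank ℝ U] (f '' (D ∩ B)) ≤
        2 ^ Module.finrank ℝ U * volume B * ENNReal.ofReal (1 / ((k : ℝ) + 1)) := by
      intro k
      set τ := 1 / ((k : ℝ) + 1) with hτ
      have hs : ∀ L : U →L[ℝ] V, ∃ s : NNReal, s ≠ 0 ∧
          (¬ Function.Injective L → (scaledGraph L s).normDet < τ) := by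
        intro L
        by_cases hL : Function.Injective L
        · exact ⟨1, one_ne_zero, fun h => absurd hL h⟩
        · obtain ⟨s, hs0, hs⟩ := exists_normDet_scaledGraph_lt hL
            (show 0 < τ by rw [hτ]; positivity)
          exact ⟨⟨s, hs0.le⟩, fun h => hs0.ne' (congrArg NNReal.toReal h), fun _ => hs⟩
      choose s hs0 hs using hs
      rcases (D ∩ B).eq_empty_or_nonempty with hempty | hne
      · simp [hempty]
      obtain ⟨t, A, hdisj, hmeas, hcover, happrox, hA⟩ :=
        exists_partition_approximatesLinearOn_of_hasFDerivWithinAt f (D ∩ B) f'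
          (fun x hx => (hf x hx.1).mono inter_subset_left) s hs0
      calc μHE[Module.finrank ℝ U] (f '' (D ∩ B))
          ≤ μHE[Module.finrank ℝ U] (⋃ i, f '' (D ∩ B ∩ t i)) := by
            rw [← image_iUnion, ← inter_iUnion, inter_eq_left.2 hcover]
        _ ≤ ∑' i, μHE[Module.finrank ℝ U] (f '' (D ∩ B ∩ t i)) := measure_iUnion_le _
        _ ≤ ∑' i, 2 ^ Module.finrank ℝ U * (ENNReal.ofReal τ * volume (B ∩ t i)) := by
            refine ENNReal.tsum_le_tsum fun i => ?_
            refine (happrox i).euclideanHausdorffMeasure_image_le.trans ?_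
            gcongr
            · obtain ⟨y, hy, hAy⟩ := hA hne i
              exact (hs _ (hAy ▸ hf' y hy.1)).le
            · exact inter_subset_right
        _ = 2 ^ Module.finrank ℝ U * (ENNReal.ofReal τ * volume (⋃ i, B ∩ t i)) := by
            rw [ENNReal.tsum_mul_left, ENNReal.tsum_mul_left, measure_iUnion]
            · exact fun i j hij => (hdisj hij).mono inter_subset_right inter_subset_right
            · exact fun i => measurableSet_ball.inter (hmeas i)
        _ ≤ 2 ^ Module.finrank ℝ U * (ENNReal.ofReal τ * volume B) := by
            gcongr
            exact iUnion_subset fun i => inter_subset_left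
        _ = _ := by ring
    have hlim : Filter.Tendsto (fun k : ℕ => 2 ^ Module.finrank ℝ U * volume B *
        ENNReal.ofReal (1 / ((k : ℝ) + 1))) Filter.atTop (nhds 0) := by
      have h1 := ENNReal.tendsto_ofReal (tendsto_one_div_add_atTop_nhds_zero_nat (𝕜 := ℝ))
      have h2 := ENNReal.Tendsto.const_mul (a := 2 ^ Module.finrank ℝ U * volume B) h1
        (Or.inr (ENNReal.mul_ne_top (by finiteness) measure_ball_lt_top.ne))
      simpa using h2
    exact nonpos_iff_eq_zero.1 (ge_of_tendsto' hlim hle)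
  have hD : D = ⋃ R : ℕ, D ∩ Metric.ball 0 R := by
    rw [← inter_iUnion, Metric.iUnion_ball_nat, inter_univ]
  rw [hD, image_iUnion]
  exact measure_iUnion_null hbdd

end Singular

/-! ### Covering rectifiable sets by flat closed pieces -/

section Flat

variable {U V : Type*} [NormedAddCommGroup U] [NormedSpace ℝ U] [FiniteDimensional ℝ U]
  [NormedAddCommGroup V] [InnerProductSpace ℝ V]

theorem exists_norm_eq_one_forall_inner_eq_zero (L : U →L[ℝ] V)
    (h : Module.finrank ℝ U < Module.finrank ℝ V) : ∃ ν : V, ‖ν‖ = 1 ∧ ∀ z, ⟪ν, L z⟫ = 0 := by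
  have hne : L.toLinearMap.rangeᗮ ≠ ⊥ := by
    intro h0
    rw [Submodule.orthogonal_eq_bot_iff] at h0
    have := LinearMap.finrank_range_le L.toLinearMap
    rw [h0, finrank_top] at this
    omega
  obtain ⟨w, hw, hw0⟩ := Submodule.exists_mem_ne_zero_of_ne_bot hne
  refine ⟨(‖w‖⁻¹ : ℝ) • w, norm_smul_inv_norm hw0, fun z => ?_⟩
  have h0 : ⟪w, L z⟫ = 0 := (Submodule.mem_orthogonal' _ _).1 hw _ ⟨z, rfl⟩
  rw [inner_smul_left, h0, mul_zero]

/-- Take `ν` orthogonal to the range of `L`, `K` an antilipschitz constant of `L`, and `r = e ν / (K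
* (1 + e ν))`. With `d = f x - f y` and `w = L (x - y)`, the error satisfies `‖d - w‖ ≤ e ν / (1 + e
ν) * ‖w‖`, hence `‖d - w‖ ≤ e ν * ‖d‖`, and it bounds `|⟪ν, d⟫|`. The tolerance is a function of `ν`
because the normal is only known once `L` is. -/
theorem exists_forall_approximatesLinearOn_isFlat {L : U →L[ℝ] V} (hL : Function.Injective L)
    (h : Module.finrank ℝ U < Module.finrank ℝ V) {e : V → ℝ} (he : ∀ ν, 0 < e ν) :
    ∃ ν : V, ‖ν‖ = 1 ∧ ∃ r : NNReal, r ≠ 0 ∧ ∀ (f : U → V) (T : Set U),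
      ApproximatesLinearOn f L T r → IsFlat ν (e ν) (f '' T) := by
  obtain ⟨ν, hν, hνL⟩ := exists_norm_eq_one_forall_inner_eq_zero L h
  obtain ⟨K, hK, hanti⟩ := L.toLinearMap.exists_antilipschitzWith (LinearMap.ker_eq_bot.2 hL)
  have hK' : (0 : ℝ) < K := hK
  have hpos : 0 < e ν / (K * (1 + e ν)) := by
    have := he ν
    positivity
  refine ⟨ν, hν, ⟨_, hpos.le⟩, fun h => hpos.ne' (congrArg NNReal.toReal h), fun f T hf => ?_⟩
  rintro _ ⟨x, hx, rfl⟩ _ ⟨y, hy, rfl⟩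
  have h1 : ‖f x - f y - L (x - y)‖ ≤ e ν / (K * (1 + e ν)) * ‖x - y‖ := hf x hx y hy
  have h2 : ⟪ν, f x - f y⟫ = ⟪ν, f x - f y - L (x - y)⟫ := by
    rw [inner_sub_right ν (f x - f y), hνL, sub_zero]
  have h3 : |⟪ν, f x - f y⟫| ≤ ‖f x - f y - L (x - y)‖ := by
    rw [h2]
    simpa [hν] using abs_real_inner_le_norm ν (f x - f y - L (x - y))
  have h4 : ‖x - y‖ ≤ K * ‖L (x - y)‖ := by
    simpa [dist_eq_norm] using hanti.le_mul_dist x y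
  have h5 := norm_sub_norm_le (L (x - y)) (L (x - y) - (f x - f y))
  rw [sub_sub_cancel, norm_sub_rev] at h5
  have h6 : e ν / (K * (1 + e ν)) * ‖x - y‖ * (1 + e ν) ≤ e ν * ‖L (x - y)‖ := by
    have h7 : e ν / (K * (1 + e ν)) * ‖x - y‖ * (1 + e ν) = e ν * (‖x - y‖ / K) := by
      have := he ν
      field_simp
    rw [h7]
    have := he ν
    gcongr
    rwa [div_le_iff₀' hK']
  nlinarith [he ν, mul_le_mul_of_nonneg_left h5 (he ν).le, mul_le_mul_of_nonneg_left h1 (he ν).le]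

end Flat

/-- Up to a negligible set, a Lipschitz image of `ℝᵐ` in a space of larger dimension is covered by
countably many closed sets that are as flat as prescribed. -/
theorem LipschitzWith.exists_isFlat_cover {V : Type*} [NormedAddCommGroup V]
    [InnerProductSpace ℝ V] [FiniteDimensional ℝ V] [MeasurableSpace V] [BorelSpace V] {m : ℕ}
    (hV : m < Module.finrank ℝ V) {f : EuclideanSpace ℝ (Fin m) → V} {C : NNReal}
    (hf : LipschitzWith C f) {e : V → ℝ} (he : ∀ ν, 0 < e ν) :
    ∃ (K : ℕ → Set V) (ν : ℕ → V), (∀ i, IsClosed (K i)) ∧ (∀ i, ‖ν i‖ = 1) ∧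
      (∀ i, IsFlat (ν i) (e (ν i)) (K i)) ∧ μHE[m] (range f \ ⋃ i, K i) = 0 := by
  have hfr : Module.finrank ℝ (EuclideanSpace ℝ (Fin m)) = m := by simp
  have hV' : Module.finrank ℝ (EuclideanSpace ℝ (Fin m)) < Module.finrank ℝ V := by rwa [hfr]
  have hr : ∀ L : EuclideanSpace ℝ (Fin m) →L[ℝ] V, ∃ ν : V, ‖ν‖ = 1 ∧ ∃ r : NNReal, r ≠ 0 ∧
      (Function.Injective L → ∀ T, ApproximatesLinearOn f L T r → IsFlat ν (e ν) (f '' T)) := by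
    intro L
    by_cases hL : Function.Injective L
    · obtain ⟨ν, hν, r, hr0, hr⟩ := exists_forall_approximatesLinearOn_isFlat hL hV' he
      exact ⟨ν, hν, r, hr0, fun _ => hr f⟩
    · obtain ⟨ν, hν, -⟩ := exists_norm_eq_one_forall_inner_eq_zero L hV'
      exact ⟨ν, hν, 1, one_ne_zero, fun h => absurd h hL⟩
  choose ν hν r hr0 hr using hr
  -- `N` is null by Rademacher's theorem and `D` has null image, so only the image of `G` has to be
  -- covered.
  set N := {x | ¬ DifferentiableAt ℝ f x}
  set D := {x | DifferentiableAt ℝ f x ∧ ¬ Function.Injective (fderiv ℝ f x)}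
  set G := {x | DifferentiableAt ℝ f x ∧ Function.Injective (fderiv ℝ f x)}
  obtain ⟨t, A, -, hcover, happrox, hA⟩ :=
    exists_closed_cover_approximatesLinearOn_of_hasFDerivWithinAt f G (fderiv ℝ f)
      (fun x hx => hx.1.hasFDerivAt.hasFDerivWithinAt) r hr0
  -- Flatness survives closure, and closed pieces can later be made disjoint while remaining
  -- σ-compact.
  refine ⟨fun i => closure (f '' (G ∩ t i)), fun i => ν (A i), fun i => isClosed_closure,
    fun i => hν _, fun i => IsFlat.closure ?_, ?_⟩
  · rcases G.eq_empty_or_nonempty with hG | hG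
    · simp [hG, IsFlat]
    · obtain ⟨y, hy, hAy⟩ := hA hG i
      exact hr _ (hAy ▸ hy.2) _ (happrox i)
  · have hN : μHE[m] (f '' N) = 0 := by
      have h1 : volume N = 0 := hf.ae_differentiableAt
      have h2 := euclideanHausdorffMeasure_image_le_of_dist_le m (φ := f) (ψ := id) (A := N)
        (C := C) fun x _ y _ => hf.dist_le_mul x y
      rw [image_id, EuclideanSpace.euclideanHausdorffMeasure_eq_volume, h1, mul_zero] at h2
      exact nonpos_iff_eq_zero.1 h2
    have hD : μHE[m] (f '' D) = 0 := by
      have := euclideanHausdorffMeasure_image_eq_zero_of_not_injective_fderiv (f := f)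
        (f' := fderiv ℝ f) (D := D) (fun x hx => hx.1.hasFDerivAt.hasFDerivWithinAt)
        fun x hx => hx.2
      rwa [hfr] at this
    refine measure_mono_null ?_ (measure_union_null hN hD)
    rintro _ ⟨⟨x, rfl⟩, hx⟩
    by_contra hnot
    simp only [mem_union, not_or] at hnot
    have hd : DifferentiableAt ℝ f x := by
      by_contra h
      exact hnot.1 ⟨x, h, rfl⟩
    have hinj : Function.Injective (fderiv ℝ f x) := by
      by_contra h
      exact hnot.2 ⟨x, ⟨hd, h⟩, rfl⟩
    obtain ⟨i, hi⟩ := mem_iUnion.1 (hcover (show x ∈ G from ⟨hd, hinj⟩))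
    exact hx (mem_iUnion.2 ⟨i, subset_closure ⟨x, ⟨⟨hd, hinj⟩, hi⟩, rfl⟩⟩)

theorem IsRectifiable.exists_isFlat_cover {m n : ℕ} (hmn : m < n)
    {S : Set (EuclideanSpace ℝ (Fin n))}
    (hS : IsRectifiable m S) {e : EuclideanSpace ℝ (Fin n) → ℝ} (he : ∀ ν, 0 < e ν) :
    ∃ (K : ℕ → Set (EuclideanSpace ℝ (Fin n))) (ν : ℕ → EuclideanSpace ℝ (Fin n)),
      (∀ i, IsClosed (K i)) ∧ (∀ i, ‖ν i‖ = 1) ∧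
      (∀ i, IsFlat (ν i) (e (ν i)) (K i)) ∧ μHE[m] (S \ ⋃ i, K i) = 0 := by
  obtain ⟨f, hf, hnull⟩ := hS
  have h : ∀ i, ∃ (K : ℕ → Set (EuclideanSpace ℝ (Fin n))) (ν : ℕ → EuclideanSpace ℝ (Fin n)),
      (∀ i, IsClosed (K i)) ∧ (∀ i, ‖ν i‖ = 1) ∧
      (∀ i, IsFlat (ν i) (e (ν i)) (K i)) ∧ μHE[m] (range (f i) \ ⋃ i, K i) = 0 := fun i => by
    obtain ⟨C, hC⟩ := hf i
    exact hC.exists_isFlat_cover (by simpa using hmn) he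
  choose K ν hK hν hflat hKnull using h
  refine ⟨fun j => K j.unpair.1 j.unpair.2, fun j => ν j.unpair.1 j.unpair.2, fun j => hK _ _,
    fun j => hν _ _, fun j => hflat _ _, ?_⟩
  refine measure_mono_null ?_ (measure_union_null hnull (measure_iUnion_null hKnull))
  rintro x ⟨hxS, hx⟩
  by_cases hxf : x ∈ ⋃ i, range (f i)
  · obtain ⟨i, hi⟩ := mem_iUnion.1 hxf
    refine Or.inr (mem_iUnion.2 ⟨i, hi, fun hxK => hx ?_⟩)
    obtain ⟨j, hj⟩ := mem_iUnion.1 hxK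
    exact mem_iUnion.2 ⟨Nat.pair i j, by simpa using hj⟩
  · exact Or.inl ⟨hxS, hxf⟩

/-! ### The constant: the mean of `|⟪p, ν⟫|` over the sphere -/

theorem integral_Ioi_pow_mul_exp_neg_sq (k : ℕ) :
    ∫ r in Ioi (0 : ℝ), r ^ k * Real.exp (-r ^ 2) = 1 / 2 * Real.Gamma ((k + 1) / 2) := by
  have h := integral_rpow_mul_exp_neg_rpow (p := 2) (q := k) two_pos
    (by have : (0 : ℝ) ≤ k := k.cast_nonneg
        linarith)
  rw [← h]
  refine setIntegral_congr_fun measurableSet_Ioi fun r hr => ?_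
  simp

theorem integral_abs_mul_exp_neg_sq : ∫ t : ℝ, |t| * Real.exp (-t ^ 2) = 1 := by
  have h1 := integral_comp_abs (f := fun t : ℝ => t * Real.exp (-t ^ 2))
  have h2 := integral_Ioi_pow_mul_exp_neg_sq 1
  simp only [sq_abs] at h1
  simp only [pow_one] at h2
  rw [h1, h2]
  norm_num

/-- In an orthonormal basis that starts with `ν` the integrand is a product: the first coordinate
contributes 1, each of the others `√π`. -/
theorem integral_abs_inner_mul_exp_neg_norm_sq {m : ℕ} {ν : EuclideanSpace ℝ (Fin (m + 1))}
    (hν : ‖ν‖ = 1) :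
    ∫ x : EuclideanSpace ℝ (Fin (m + 1)), |⟪x, ν⟫| * Real.exp (-‖x‖ ^ 2) = √Real.pi ^ m := by
  obtain ⟨b, hb⟩ := Orthonormal.exists_orthonormalBasis_extension_of_card_eq (𝕜 := ℝ)
    (E := EuclideanSpace ℝ (Fin (m + 1))) (ι := Fin (m + 1)) (by simp) (v := fun _ => ν)
    (s := {0}) (by
      rw [orthonormal_subsingleton_iff]
      exact fun _ => hν)
  have hb0 : b 0 = ν := hb 0 rfl
  let f : Fin (m + 1) → ℝ → ℝ := fun i t => (if i = 0 then |t| else 1) * Real.exp (-t ^ 2)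
  calc ∫ x : EuclideanSpace ℝ (Fin (m + 1)), |⟪x, ν⟫| * Real.exp (-‖x‖ ^ 2)
      = ∫ y : EuclideanSpace ℝ (Fin (m + 1)), |y 0| * Real.exp (-‖y‖ ^ 2) := by
        rw [← b.measurePreserving_repr.integral_comp b.repr.toHomeomorph.measurableEmbedding
          fun y : EuclideanSpace ℝ (Fin (m + 1)) => |y 0| * Real.exp (-‖y‖ ^ 2)]
        refine integral_congr_ae (Filter.Eventually.of_forall fun x => ?_)
        simp only [b.repr_apply_apply, hb0, LinearIsometryEquiv.norm_map, real_inner_comm ν x]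
    _ = ∫ y : Fin (m + 1) → ℝ, ∏ i, f i (y i) := by
        rw [← (EuclideanSpace.volume_preserving_symm_measurableEquiv_toLp
          (Fin (m + 1))).symm.integral_comp (MeasurableEquiv.measurableEmbedding _)]
        refine integral_congr_ae (Filter.Eventually.of_forall fun y => ?_)
        simp only [f, Finset.prod_mul_distrib, ← Real.exp_sum, Finset.sum_neg_distrib,
          EuclideanSpace.real_norm_sq_eq]
        simp
    _ = √Real.pi ^ m := by
        rw [integral_fintype_prod_volume_eq_prod, Fin.prod_univ_succ]
        have h0 : ∫ t, f 0 t = 1 := by simpa [f] using integral_abs_mul_exp_neg_sq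
        have h1 : ∀ i : Fin m, ∫ t, f i.succ t = √Real.pi := fun i => by
          simpa [f, Fin.succ_ne_zero] using integral_gaussian 1
        simp [h0, h1]

theorem unitBallVolume_eq (m : ℕ) :
    unitBallVolume m = ENNReal.ofReal (√Real.pi ^ m / Real.Gamma (m / 2 + 1)) := by
  rcases m with _ | m
  · have h : Metric.ball (0 : EuclideanSpace ℝ (Fin 0)) 1 = {0} := by
      ext x
      simp [Subsingleton.elim x 0]
    rw [unitBallVolume, h, ← EuclideanSpace.euclideanHausdorffMeasure_eq_volume,
      Measure.euclideanHausdorffMeasure_zero, Measure.hausdorffMeasure_zero_singleton]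
    simp
  · rw [unitBallVolume, EuclideanSpace.volume_ball]
    simp

open Measure in
-- The Gaussian integral above, in polar coordinates, is the spherical integral times a radial one.
-- Homogeneity of `|⟪x, ν⟫|` adds a factor `r` to the density `r ^ m`, so the radial integral is
-- `Γ(m / 2 + 1) / 2`.
theorem integral_toSphere_abs_inner {m : ℕ} {ν : EuclideanSpace ℝ (Fin (m + 1))}
    (hν : ‖ν‖ = 1) :
    ∫ p, |⟪(p : EuclideanSpace ℝ (Fin (m + 1))), ν⟫|
      ∂(volume : Measure (EuclideanSpace ℝ (Fin (m + 1)))).toSphere =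
      2 * (√Real.pi ^ m / Real.Gamma (m / 2 + 1)) := by
  set μ := (volume : Measure (EuclideanSpace ℝ (Fin (m + 1))))
  have hpolar : ∫ x : EuclideanSpace ℝ (Fin (m + 1)), |⟪x, ν⟫| * Real.exp (-‖x‖ ^ 2) =
      (∫ p, |⟪(p : EuclideanSpace ℝ (Fin (m + 1))), ν⟫| ∂μ.toSphere) *
        ∫ r : Ioi (0 : ℝ), r.1 * Real.exp (-r.1 ^ 2) ∂volumeIoiPow m := by
    calc ∫ x : EuclideanSpace ℝ (Fin (m + 1)), |⟪x, ν⟫| * Real.exp (-‖x‖ ^ 2)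
        = ∫ x : ({(0)}ᶜ : Set (EuclideanSpace ℝ (Fin (m + 1)))),
            |⟪x.1, ν⟫| * Real.exp (-‖x.1‖ ^ 2) ∂(μ.comap (↑)) := by
          rw [integral_subtype_comap (measurableSet_singleton _).compl
            fun x => |⟪x, ν⟫| * Real.exp (-‖x‖ ^ 2), restrict_compl_singleton]
      _ = ∫ q : UnitSphere (m + 1) × Ioi (0 : ℝ),
            |⟪(q.1 : EuclideanSpace ℝ (Fin (m + 1))), ν⟫| *
              (q.2.1 * Real.exp (-q.2.1 ^ 2)) ∂μ.toSphere.prod (volumeIoiPow m) := by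
          have h := μ.measurePreserving_homeomorphUnitSphereProd
          rw [show Module.finrank ℝ (EuclideanSpace ℝ (Fin (m + 1))) - 1 = m by simp] at h
          rw [← h.integral_comp (Homeomorph.measurableEmbedding _)]
          refine integral_congr_ae (Filter.Eventually.of_forall fun x => ?_)
          have hx : 0 < ‖(x : EuclideanSpace ℝ (Fin (m + 1)))‖ := norm_pos_iff.2 x.2
          simp only [homeomorphUnitSphereProd_apply_fst_coe,
            homeomorphUnitSphereProd_apply_snd_coe, inner_smul_left, abs_mul]
          simp only [RCLike.conj_to_real, abs_inv, abs_norm]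
          field_simp
      _ = _ := integral_prod_mul (fun p : UnitSphere (m + 1) =>
            |⟪(p : EuclideanSpace ℝ (Fin (m + 1))), ν⟫|)
            fun r : Ioi (0 : ℝ) => r.1 * Real.exp (-r.1 ^ 2)
  have hradial : ∫ r : Ioi (0 : ℝ), r.1 * Real.exp (-r.1 ^ 2) ∂volumeIoiPow m =
      1 / 2 * Real.Gamma (m / 2 + 1) := by
    simp only [volumeIoiPow, ENNReal.ofReal]
    rw [integral_withDensity_eq_integral_smul (measurable_subtype_coe.pow_const _).real_toNNReal,
      integral_subtype_comap measurableSet_Ioi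
        fun a => Real.toNNReal (a ^ m) • (a * Real.exp (-a ^ 2))]
    have h := integral_Ioi_pow_mul_exp_neg_sq (m + 1)
    have h2 : ((m + 1 : ℕ) + 1 : ℝ) / 2 = m / 2 + 1 := by push_cast; ring
    rw [h2] at h
    rw [← h]
    refine setIntegral_congr_fun measurableSet_Ioi fun r hr => ?_
    simp only [NNReal.smul_def, Real.coe_toNNReal _ (pow_nonneg hr.out.le _), smul_eq_mul]
    ring
  have hΓ : 0 < Real.Gamma (m / 2 + 1) := Real.Gamma_pos_of_pos (by positivity)
  rw [integral_abs_inner_mul_exp_neg_norm_sq hν, hradial] at hpolar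
  rw [hpolar]
  field_simp

theorem lintegral_toSphere_abs_inner {m : ℕ} {ν : EuclideanSpace ℝ (Fin (m + 1))}
    (hν : ‖ν‖ = 1) :
    ∫⁻ p, ENNReal.ofReal |⟪(p : EuclideanSpace ℝ (Fin (m + 1))), ν⟫|
      ∂(volume : Measure (EuclideanSpace ℝ (Fin (m + 1)))).toSphere = 2 * unitBallVolume m := by
  rw [← ofReal_integral_eq_lintegral_ofReal, integral_toSphere_abs_inner hν, unitBallVolume_eq,
    ENNReal.ofReal_mul zero_le_two, ENNReal.ofReal_ofNat]
  · refine Integrable.of_bound (C := 1) (Continuous.aestronglyMeasurable (by fun_prop))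
      (Filter.Eventually.of_forall fun p => ?_)
    have := abs_real_inner_le_norm (p : EuclideanSpace ℝ (Fin (m + 1))) ν
    rw [OrientedLine.norm_coe_unitSphere, hν, one_mul] at this
    simpa using this
  · exact Filter.Eventually.of_forall fun p => abs_nonneg _

open Pointwise in
-- The spherical measure is computed from the volume of the cone, which here lies in a proper
-- subspace.
theorem toSphere_inner_eq_zero {m : ℕ} {ν : EuclideanSpace ℝ (Fin (m + 1))} (hν : ‖ν‖ = 1) :
    (volume : Measure (EuclideanSpace ℝ (Fin (m + 1)))).toSphere
      {p | ⟪(p : EuclideanSpace ℝ (Fin (m + 1))), ν⟫ = 0} = 0 := by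
  have hmeas : MeasurableSet
      {p : UnitSphere (m + 1) | ⟪(p : EuclideanSpace ℝ (Fin (m + 1))), ν⟫ = 0} :=
    (isClosed_eq (by fun_prop) continuous_const).measurableSet
  rw [Measure.toSphere_apply' _ hmeas]
  have hsub : Ioo (0 : ℝ) 1 • ((↑) '' {p : UnitSphere (m + 1) |
      ⟪(p : EuclideanSpace ℝ (Fin (m + 1))), ν⟫ = 0}) ⊆
      ((Submodule.span ℝ {ν})ᗮ : Set (EuclideanSpace ℝ (Fin (m + 1)))) := by
    rintro _ ⟨r, -, _, ⟨p, hp, rfl⟩, rfl⟩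
    rw [SetLike.mem_coe, Submodule.mem_orthogonal_singleton_iff_inner_left]
    change ⟪r • (p : EuclideanSpace ℝ (Fin (m + 1))), ν⟫ = 0
    rw [inner_smul_left, show ⟪(p : EuclideanSpace ℝ (Fin (m + 1))), ν⟫ = 0 from hp, mul_zero]
  have hnull : volume ((Submodule.span ℝ {ν})ᗮ : Set (EuclideanSpace ℝ (Fin (m + 1)))) = 0 := by
    refine Measure.addHaar_submodule _ _ fun h => ?_
    have : ν ∈ (Submodule.span ℝ {ν})ᗮ := h ▸ Submodule.mem_top
    rw [Submodule.mem_orthogonal_singleton_iff_inner_left, real_inner_self_eq_norm_sq, hν] at this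
    norm_num at this
  rw [measure_mono_null hsub hnull, mul_zero]

/-! ### Crofton's formula: flat pieces, summation, passage to the limit -/

namespace OrientedLine

variable {m : ℕ}

open Filter Topology in
theorem tendsto_toSphere_abs_inner_lt {ν : EuclideanSpace ℝ (Fin (m + 1))} (hν : ‖ν‖ = 1) :
    Tendsto (fun k : ℕ => (volume : Measure (EuclideanSpace ℝ (Fin (m + 1)))).toSphere
      {p | |⟪(p : EuclideanSpace ℝ (Fin (m + 1))), ν⟫| < 1 / ((k : ℝ) + 1)}) atTop (𝓝 0) := by
  rw [← toSphere_inner_eq_zero hν]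
  have hInter : {p : UnitSphere (m + 1) | ⟪(p : EuclideanSpace ℝ (Fin (m + 1))), ν⟫ = 0} =
      ⋂ k : ℕ, {p : UnitSphere (m + 1) |
        |⟪(p : EuclideanSpace ℝ (Fin (m + 1))), ν⟫| < 1 / ((k : ℝ) + 1)} := by
    ext p
    simp only [mem_ofPred_eq, mem_iInter]
    constructor
    · intro h k
      rw [h, abs_zero]
      positivity
    · intro h
      by_contra h0
      obtain ⟨k, hk⟩ := exists_nat_one_div_lt (abs_pos.2 h0)
      exact (h k).not_gt hk
  rw [hInter]
  refine tendsto_measure_iInter_atTop (fun k => ?_) (fun i j hij p hp => ?_) ⟨0, measure_ne_top _ _⟩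
  · exact (isOpen_lt (by fun_prop) continuous_const).measurableSet.nullMeasurableSet
  · refine lt_of_lt_of_le (mem_ofPred_eq ▸ hp : |⟪(p : EuclideanSpace ℝ (Fin (m + 1))), ν⟫| < _) ?_
    exact one_div_le_one_div_of_le (by positivity) (by gcongr)

open Filter Topology in
/-- Crofton's formula holds approximately for flat sets. -/
theorem exists_forall_isFlat_lintegral_intersections {ν : EuclideanSpace ℝ (Fin (m + 1))}
    (hν : ‖ν‖ = 1) {a b : ℝ≥0∞} (ha : a < 2 * unitBallVolume m) (hb : 2 * unitBallVolume m < b) :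
    ∃ ε > 0, ∀ A : Set (EuclideanSpace ℝ (Fin (m + 1))), IsFlat ν ε A → IsSigmaCompact A →
      a * μHE[m] A ≤ ∫⁻ l, intersections A l ∂invariantMeasure (m + 1) ∧
      ∫⁻ l, intersections A l ∂invariantMeasure (m + 1) ≤ b * μHE[m] A := by
  set σ := (volume : Measure (EuclideanSpace ℝ (Fin (m + 1)))).toSphere
  set c := 2 * unitBallVolume m
  let δ : UnitSphere (m + 1) → ℝ≥0∞ := fun p =>
    ENNReal.ofReal |⟪(p : EuclideanSpace ℝ (Fin (m + 1))), ν⟫|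
  have hδmeas : Measurable δ := (Continuous.measurable (by fun_prop)).ennreal_ofReal
  have hδ : ∫⁻ p, δ p ∂σ = c := lintegral_toSphere_abs_inner hν
  have hδ1 : ∀ p, δ p ≤ 1 := fun p => by
    have := abs_real_inner_le_norm (p : EuclideanSpace ℝ (Fin (m + 1))) ν
    rw [norm_coe_unitSphere, hν, one_mul] at this
    exact ENNReal.ofReal_le_one.2 this
  let B : ℕ → Set (UnitSphere (m + 1)) := fun k =>
    {p | |⟪(p : EuclideanSpace ℝ (Fin (m + 1))), ν⟫| < 1 / ((k : ℝ) + 1)}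
  have hBmeas : ∀ k, MeasurableSet (B k) := fun k =>
    (isOpen_lt (by fun_prop) continuous_const).measurableSet
  let C : ℕ → NNReal := fun k => 1 + 1 / ((k : NNReal) + 1)
  have hClim : Tendsto (fun k => (C k : ℝ≥0∞)) atTop (𝓝 1) := by
    have h := (tendsto_one_div_add_atTop_nhds_zero_nat (𝕜 := NNReal)).const_add 1
    rw [add_zero] at h
    exact ENNReal.tendsto_coe.2 h
  have hBlim : Tendsto (fun k => σ (B k)) atTop (𝓝 0) := tendsto_toSphere_abs_inner_lt hν
  have hcont : ∀ d : ℝ≥0∞, d ≠ ⊤ → ∀ j : ℕ,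
      Tendsto (fun k => (C k : ℝ≥0∞) ^ j * d + σ (B k)) atTop (𝓝 d) := by
    intro d hd j
    have h := (ENNReal.Tendsto.mul_const (ENNReal.Tendsto.pow (n := j) hClim)
      (Or.inr hd)).add hBlim
    simpa using h
  -- One `k` fixes both the distortion `C k` and the band `B k` of nearly tangent directions. The
  -- upper bound loses `C ^ m`, the lower one `C ^ (m + m)`, and each loses at most the measure of
  -- the band.
  obtain ⟨k, hkb, hka⟩ := (((tendsto_order.1 (hcont c hb.ne_top m)).2 b hb).and
    ((tendsto_order.1 (hcont a ha.ne_top (m + m))).2 c ha)).exists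
  have hC1 : 1 < C k := lt_add_of_pos_right _ (by positivity)
  obtain ⟨ε, hε, hflat⟩ := exists_pos_forall_isFlat_perpProj (V := EuclideanSpace ℝ (Fin (m + 1)))
    (m := m) (by simp) hν (η := 1 / ((k : ℝ) + 1)) (by positivity)
    (by rw [div_le_one (by positivity)]; linarith [(k.cast_nonneg : (0 : ℝ) ≤ k)]) hC1
  refine ⟨ε, hε, fun A hA hAσ => ?_⟩
  rw [lintegral_intersections hAσ]
  have hgood : ∀ p ∉ B k,
      ∫⁻ l, intersections A l ∂parallelMeasure p ≤ (C k : ℝ≥0∞) ^ m * (δ p * μHE[m] A) ∧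
      δ p * μHE[m] A ≤ (C k : ℝ≥0∞) ^ m * ((C k : ℝ≥0∞) ^ m *
        ∫⁻ l, intersections A l ∂parallelMeasure p) := by
    intro p hp
    obtain ⟨hinj, h1, h2⟩ := hflat A hA p (norm_coe_unitSphere p) (not_lt.1 hp)
    rw [lintegral_parallelMeasure_intersections_of_injOn p hAσ hinj]
    exact ⟨h1, h2⟩
  constructor
  -- Since `δ ≤ 1`, discarding the band lowers the integral of `δ` by at most `σ (B k)`.
  · have h1 : c ≤ ∫⁻ p in (B k)ᶜ, δ p ∂σ + σ (B k) := by
      rw [← hδ, ← lintegral_add_compl δ (hBmeas k), add_comm]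
      gcongr
      refine (setLIntegral_mono measurable_const fun p _ => hδ1 p).trans_eq ?_
      simp
    have h2 : (C k : ℝ≥0∞) ^ (m + m) * a ≤ ∫⁻ p in (B k)ᶜ, δ p ∂σ :=
      (ENNReal.add_le_add_iff_right (measure_ne_top _ _)).1 (hka.le.trans h1)
    have h3 : (C k : ℝ≥0∞) ^ (m + m) * (a * μHE[m] A) ≤ (C k : ℝ≥0∞) ^ (m + m) *
        ∫⁻ p, ∫⁻ l, intersections A l ∂parallelMeasure p ∂σ := by
      calc (C k : ℝ≥0∞) ^ (m + m) * (a * μHE[m] A)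
          = (C k : ℝ≥0∞) ^ (m + m) * a * μHE[m] A := by ring
        _ ≤ (∫⁻ p in (B k)ᶜ, δ p ∂σ) * μHE[m] A := by gcongr
        _ = ∫⁻ p in (B k)ᶜ, δ p * μHE[m] A ∂σ := (lintegral_mul_const _ hδmeas).symm
        _ ≤ ∫⁻ p in (B k)ᶜ, (C k : ℝ≥0∞) ^ (m + m) *
              ∫⁻ l, intersections A l ∂parallelMeasure p ∂σ := by
            refine setLIntegral_mono' (hBmeas k).compl fun p hp => ?_
            rw [pow_add, mul_assoc]
            exact (hgood p hp).2
        _ ≤ ∫⁻ p, (C k : ℝ≥0∞) ^ (m + m) *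
              ∫⁻ l, intersections A l ∂parallelMeasure p ∂σ := setLIntegral_le_lintegral _ _
        _ = _ := lintegral_const_mul' _ _ (by finiteness)
    have hC0 : (C k : ℝ≥0∞) ^ (m + m) ≠ 0 :=
      pow_ne_zero _ (ENNReal.coe_ne_zero.2 (zero_lt_one.trans hC1).ne')
    exact (ENNReal.mul_le_mul_iff_right hC0 (by finiteness)).1 h3
  · calc ∫⁻ p, ∫⁻ l, intersections A l ∂parallelMeasure p ∂σ
        ≤ ∫⁻ p, (δ p * ((C k : ℝ≥0∞) ^ m * μHE[m] A) +
            (B k).indicator (fun _ => μHE[m] A) p) ∂σ := by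
          refine lintegral_mono fun p => ?_
          by_cases hp : p ∈ B k
          · rw [indicator_of_mem hp]
            exact (lintegral_parallelMeasure_intersections_le p hAσ).trans le_add_self
          · rw [indicator_of_notMem hp, add_zero, mul_left_comm]
            exact (hgood p hp).1
      _ = c * ((C k : ℝ≥0∞) ^ m * μHE[m] A) + μHE[m] A * σ (B k) := by
          rw [lintegral_add_left (hδmeas.mul_const _), lintegral_mul_const _ hδmeas, hδ,
            lintegral_indicator_const (hBmeas k)]
      _ = ((C k : ℝ≥0∞) ^ m * c + σ (B k)) * μHE[m] A := by ring
      _ ≤ b * μHE[m] A := by gcongr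

/-- For each direction, almost every foot gives a line that misses the null remainder; on such lines
the counts simply add. -/
theorem lintegral_intersections_eq_tsum {S : Set (EuclideanSpace ℝ (Fin (m + 1)))}
    (hS : IsSigmaCompact S) {A : ℕ → Set (EuclideanSpace ℝ (Fin (m + 1)))}
    (hA : ∀ i, IsSigmaCompact (A i)) (hdisj : Pairwise (Function.onFun Disjoint A))
    (hAS : ∀ i, A i ⊆ S) (hnull : μHE[m] (S \ ⋃ i, A i) = 0) :
    ∫⁻ l, intersections S l ∂invariantMeasure (m + 1) =
      ∑' i, ∫⁻ l, intersections (A i) l ∂invariantMeasure (m + 1) := by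
  have hmeas : Measurable fun l => ∑' i, intersections (A i) l :=
    Measurable.tsum fun i => measurable_intersections (hA i)
  rw [← lintegral_tsum fun i => (measurable_intersections (hA i)).aemeasurable,
    lintegral_intersections hS, invariantMeasure,
    Measure.lintegral_bind measurable_parallelMeasure.aemeasurable hmeas.aemeasurable]
  refine lintegral_congr fun p => ?_
  rw [parallelMeasure, lintegral_map (measurable_intersections hS) (measurable_ofFoot p),
    lintegral_map hmeas (measurable_ofFoot p)]
  refine lintegral_congr_ae ?_
  filter_upwards [intersections_ofFoot_ae_eq_zero p hnull] with u hu
  have hunion : S = (⋃ i, A i) ∪ S \ ⋃ i, A i := (union_sdiff_cancel (iUnion_subset hAS)).symm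
  conv_lhs => rw [hunion]
  rw [intersections_union disjoint_sdiff_right, hu, add_zero, intersections_iUnion hdisj]

theorem _root_.IsRectifiable.lintegral_intersections_mem_Icc
    {S : Set (EuclideanSpace ℝ (Fin (m + 1)))}
    (hS : IsRectifiable m S) (hSσ : IsSigmaCompact S) {a b : ℝ≥0∞}
    (ha : a < 2 * unitBallVolume m) (hb : 2 * unitBallVolume m < b) :
    a * μHE[m] S ≤ ∫⁻ l, intersections S l ∂invariantMeasure (m + 1) ∧
    ∫⁻ l, intersections S l ∂invariantMeasure (m + 1) ≤ b * μHE[m] S := by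
  -- The tolerance for every possible normal is fixed before `S` is decomposed; the value at vectors
  -- that are not unit is immaterial.
  have he : ∀ ν : EuclideanSpace ℝ (Fin (m + 1)), ∃ ε : ℝ, 0 < ε ∧ (‖ν‖ = 1 → ∀ A, IsFlat ν ε A →
      IsSigmaCompact A → a * μHE[m] A ≤ ∫⁻ l, intersections A l ∂invariantMeasure (m + 1) ∧
      ∫⁻ l, intersections A l ∂invariantMeasure (m + 1) ≤ b * μHE[m] A) := by
    intro ν
    by_cases hν : ‖ν‖ = 1
    · obtain ⟨ε, hε, h⟩ := exists_forall_isFlat_lintegral_intersections hν ha hb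
      exact ⟨ε, hε, fun _ => h⟩
    · exact ⟨1, one_pos, fun h => absurd h hν⟩
  choose e he0 he using he
  obtain ⟨K, ν, hK, hν, hflat, hnull⟩ := hS.exists_isFlat_cover m.lt_succ_self he0
  have hA : ∀ i, IsSigmaCompact (S ∩ disjointed K i) := fun i =>
    hSσ.inter (isLocallyClosed_disjointed hK i).isSigmaCompact
  have hdisj : Pairwise (Function.onFun Disjoint fun i => S ∩ disjointed K i) := fun i j hij =>
    (disjoint_disjointed K hij).mono inter_subset_right inter_subset_right
  have hnull' : μHE[m] (S \ ⋃ i, S ∩ disjointed K i) = 0 := by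
    rwa [← inter_iUnion, iUnion_disjointed, sdiff_self_inter]
  have hbound := fun i => he (ν i) (hν i) (S ∩ disjointed K i)
    ((hflat i).mono (inter_subset_right.trans (disjointed_subset K i))) (hA i)
  have hμ : μHE[m] S = ∑' i, μHE[m] (S ∩ disjointed K i) := by
    rw [← measure_iUnion hdisj fun i => (hA i).measurableSet]
    refine le_antisymm ?_ (measure_mono (iUnion_subset fun i => inter_subset_left))
    refine (measure_le_inter_add_sdiff _ S (⋃ i, S ∩ disjointed K i)).trans ?_
    rw [hnull', add_zero]
    exact measure_mono inter_subset_right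
  rw [lintegral_intersections_eq_tsum hSσ hA hdisj (fun i => inter_subset_left) hnull', hμ,
    ← ENNReal.tsum_mul_left, ← ENNReal.tsum_mul_left]
  exact ⟨ENNReal.tsum_le_tsum fun i => (hbound i).1, ENNReal.tsum_le_tsum fun i => (hbound i).2⟩

/-- Crofton's formula for rectifiable `σ`-compact sets. -/
theorem _root_.IsRectifiable.lintegral_intersections_eq {S : Set (EuclideanSpace ℝ (Fin (m + 1)))}
    (hS : IsRectifiable m S) (hSσ : IsSigmaCompact S) :
    ∫⁻ l, intersections S l ∂invariantMeasure (m + 1) = 2 * unitBallVolume m * μHE[m] S := by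
  have hpos : 0 < 2 * unitBallVolume m :=
    ENNReal.mul_pos two_ne_zero (Metric.measure_ball_pos _ _ one_pos).ne'
  have hfin : 2 * unitBallVolume m ≠ ⊤ := ENNReal.mul_ne_top (by simp) measure_ball_lt_top.ne
  -- Each inequality uses one end of the interval; the other end is set to 0, respectively to `2 *
  -- unitBallVolume m + 1`. Perturbing both factors of the product also handles infinite area.
  refine le_antisymm ?_ ?_
  · refine ENNReal.le_mul_of_forall_lt (Or.inl hpos.ne') (Or.inl hfin) fun b hb d hd => ?_
    exact (hS.lintegral_intersections_mem_Icc hSσ (hpos) hb).2.trans (by gcongr)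
  · refine ENNReal.mul_le_of_forall_lt fun a ha d hd => ?_
    have := (hS.lintegral_intersections_mem_Icc hSσ ha
      (ENNReal.lt_add_right hfin one_ne_zero)).1
    exact le_trans (by gcongr) this

end OrientedLine

theorem theorem2 (n : ℕ) (hn : 1 ≤ n) (K : Set (EuclideanSpace ℝ (Fin n))) (hK : IsCompact K)
    (hrect : IsRectifiable (n - 1) (frontier K)) :
    Measurable (OrientedLine.intersections (frontier K)) ∧
    areaOf (n - 1) (frontier K) =
      1 / (2 * unitBallVolume (n - 1)) *
        ∫⁻ l, OrientedLine.intersections (frontier K) l ∂(OrientedLine.invariantMeasure n) := by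
  have hσ : IsSigmaCompact (frontier K) :=
    (hK.of_isClosed_subset isClosed_frontier hK.isClosed.frontier_subset).isSigmaCompact
  refine ⟨OrientedLine.measurable_intersections hσ, ?_⟩
  obtain ⟨m, rfl⟩ := Nat.exists_eq_add_of_le' hn
  rw [Nat.add_sub_cancel] at hrect ⊢
  have hpos : 2 * unitBallVolume m ≠ 0 :=
    mul_ne_zero two_ne_zero (Metric.measure_ball_pos _ _ one_pos).ne'
  have hfin : 2 * unitBallVolume m ≠ ⊤ := ENNReal.mul_ne_top (by simp) measure_ball_lt_top.ne
  rw [IsRectifiable.lintegral_intersections_eq hrect hσ, ← mul_assoc, one_div,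
    ENNReal.inv_mul_cancel hpos hfin, one_mul, areaOf]
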